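/- All Banach spaces are real; $X\equiv Y$ means that $X$ and $Y$ are linearly isometric (via a surjective map). Let $V$ be the $\mathbb{Q}$-vector space of finitely supported rational sequences and let $\mathcal{P}\subseteq\mathbb{R}^V$ be the set of all pseudonorms on $V$, with the topology of pointwise convergence. Each $\mu\in\mathcal{P}$ extends uniquely to a pseudonorm on the real vector space $c_{00}$ of finitely supported real sequences, also denoted $\mu$; let $X_\mu$ be the Banach space obtained by completing the quotient of $(c_{00},\mu)$ by $\{x:\mu(x)=0\}$. Put $\mathcal{P}_\infty=\{\mu\in\mathcal{P}: \dim X_\mu=\infty\}$ and $\mathcal{B}=\{\mu\in\mathcal{P}_\infty:\mu\text{ is a norm on }c_{00}\}$, with the subspace topologies. For a separable Banach space $Z$ and $\mathcal{I}\in\{\mathcal{B},\mathcal{P}_\infty\}$, the isometry class of $Z$ in $\mathcal{I}$ is $\langle Z\rangle_{\equiv}^{\mathcal{I}}=\{\mu\in\mathcal{I}:X_\mu\equiv Z\}$. A separable Banach space is isometrically universal if it contains a linearly isometric copy of every separable Banach space. For $K\ge 1$, a $K$-isomorphism is a (not necessarily surjective) linear map $f$ with $K^{-1}\|x\|\le\|f(x)\|\le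 K\|x\|$ for all $x$. A Gurariĭ space is a separable Banach space $\mathbb{G}$ such that for every $\varepsilon>0$, every subspace $A\subseteq\mathbb{G}$ and every linear isometric embedding $g:A\to F$ into a finite-dimensional Banach space $F$ there is a $(1+\varepsilon)$-isomorphism $f:F\to\mathbb{G}$ with $\|f\circ g-\mathrm{id}_A\|\le\varepsilon$. A subset $A$ of a topological space $S$ is $G_\delta$-complete if it is $G_\delta$ in $S$ and for every zero-dimensional Polish space $Y$ and every $G_\delta$-set $D\subseteq Y$ there is a continuous $f:Y\to S$ with $f^{-1}(A)=D$. **Corollary.** A Gurariĭ space exists. Let $\mathbb{G}$ be a Gurariĭ space and let $\mathcal{I}\in\{\mathcal{B},\mathcal{P}_\infty\}$. Then $\mathbb{G}$ is isometrically universal, $\langle\mathbb{G}\rangle_{\equiv}^{\mathcal{I}}$ is a $G_\delta$-set in $\mathcal{I}$, and every isometrically universal separable Banach space $Z$ for which $\langle Z\rangle_{\equiv}^{\mathcal{I}}$ is a $G_\delta$-set in $\mathcal{I}$ satisfies $Z\equiv\mathbb{G}$. Moreover, $\langle\mathbb{G}\rangle_{\equiv}^{\mathcal{I}}$ is a $G_\delta$-complete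 set in $\mathcal{I}$. -/

import Mathlib

open Set TopologicalSpace

namespace BanachCoding

/-- The rational vector space `V` of all finitely supported sequences of rational numbers. -/
abbrev V : Type := ℕ →₀ ℚ

/-- The space of all pseudonorms on `V`. -/
abbrev PseudoNorm : Type := Seminorm ℚ V

/-- The topology of pointwise convergence on pseudonorms, i.e. the one inherited from `ℝ^V`. -/
noncomputable instance : TopologicalSpace PseudoNorm :=
  TopologicalSpace.induced (fun (μ : PseudoNorm) (v : V) => μ v) Pi.topologicalSpace

/-- The inclusion of `V` into the real vector space `c₀₀` of finitely supported real sequences. -/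
noncomputable def toReal (v : V) : ℕ →₀ ℝ := v.mapRange (fun q : ℚ => (q : ℝ)) Rat.cast_zero

/-- The weighted `ℓ₁`-pseudonorm `x ↦ ∑ i, |x i| * μ (e i)` on `c₀₀`. -/
noncomputable def weight (μ : PseudoNorm) (x : ℕ →₀ ℝ) : ℝ :=
  x.sum fun i t => |t| * μ (Finsupp.single i 1)

/-- The value at `x` of the extension of `μ` to `c₀₀`, as an infimal convolution. That this is a
pseudonorm extending `μ`, and the only one, is shown in `extend`, `extend_toReal` and
`eq_extend` below. -/
noncomputable def extendFun (μ : PseudoNorm) (x : ℕ →₀ ℝ) : ℝ :=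
  ⨅ v : V, (μ v + weight μ (x - toReal v))

theorem toReal_apply (v : V) (i : ℕ) : toReal v i = (v i : ℝ) := by simp [toReal]

theorem toReal_add (v w : V) : toReal (v + w) = toReal v + toReal w := by
  ext i; simp [toReal_apply]

theorem toReal_sub (v w : V) : toReal (v - w) = toReal v - toReal w := by
  ext i; simp [toReal_apply]

theorem toReal_smul (q : ℚ) (v : V) : toReal (q • v) = (q : ℝ) • toReal v := by
  ext i; simp [toReal_apply]

theorem weight_nonneg (μ : PseudoNorm) (x : ℕ →₀ ℝ) : 0 ≤ weight μ x :=
  Finset.sum_nonneg fun _ _ => mul_nonneg (abs_nonneg _) (apply_nonneg μ _)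

theorem weight_eq (μ : PseudoNorm) (x : ℕ →₀ ℝ) {s : Finset ℕ} (h : x.support ⊆ s) :
    weight μ x = ∑ i ∈ s, |x i| * μ (Finsupp.single i 1) :=
  Finsupp.sum_of_support_subset x h _ (by simp)

theorem weight_add (μ : PseudoNorm) (x y : ℕ →₀ ℝ) :
    weight μ (x + y) ≤ weight μ x + weight μ y := by
  classical
  rw [weight_eq μ (x + y) Finsupp.support_add,
    weight_eq μ x (Finset.subset_union_left (s₂ := y.support)),
    weight_eq μ y (Finset.subset_union_right (s₁ := x.support)), ← Finset.sum_add_distrib]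
  refine Finset.sum_le_sum fun i _ => ?_
  rw [← add_mul]
  exact mul_le_mul_of_nonneg_right (abs_add_le _ _) (apply_nonneg μ _)

theorem weight_smul (μ : PseudoNorm) (c : ℝ) (x : ℕ →₀ ℝ) :
    weight μ (c • x) = |c| * weight μ x := by
  rw [weight_eq μ (c • x) Finsupp.support_smul, weight_eq μ x subset_rfl, Finset.mul_sum]
  exact Finset.sum_congr rfl fun i _ => by simp [abs_mul, mul_assoc]

theorem le_weight (μ : PseudoNorm) (v : V) : μ v ≤ weight μ (toReal v) := by
  have hs : (toReal v).support ⊆ v.support := Finsupp.support_mapRange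
  rw [weight_eq μ _ hs]
  conv_lhs => rw [← Finsupp.sum_single v, Finsupp.sum]
  refine (map_sum_le_sum μ _ _).trans (Finset.sum_le_sum fun i _ => le_of_eq ?_)
  have : Finsupp.single i (v i) = v i • (Finsupp.single i 1 : V) := by simp
  rw [this, map_smul_eq_mul, toReal_apply, ← Rat.norm_cast_real, Real.norm_eq_abs]
where
  map_sum_le_sum (μ : PseudoNorm) (s : Finset ℕ) (f : ℕ → V) :
      μ (∑ i ∈ s, f i) ≤ ∑ i ∈ s, μ (f i) :=
    Finset.le_sum_of_subadditive μ (map_zero μ).le (map_add_le_add μ) s f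

theorem bddBelow_extend (μ : PseudoNorm) (x : ℕ →₀ ℝ) :
    BddBelow (range fun v : V => μ v + weight μ (x - toReal v)) :=
  ⟨0, by rintro _ ⟨v, rfl⟩; exact add_nonneg (apply_nonneg μ v) (weight_nonneg μ _)⟩

theorem extendFun_le (μ : PseudoNorm) (x : ℕ →₀ ℝ) (v : V) :
    extendFun μ x ≤ μ v + weight μ (x - toReal v) :=
  ciInf_le (bddBelow_extend μ x) v

theorem extendFun_toReal (μ : PseudoNorm) (v : V) : extendFun μ (toReal v) = μ v := by
  refine le_antisymm ((extendFun_le μ _ v).trans ?_) (le_ciInf fun w => ?_)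
  · simp [weight]
  · calc μ v = μ (w + (v - w)) := by simp
      _ ≤ μ w + μ (v - w) := map_add_le_add μ _ _
      _ ≤ μ w + weight μ (toReal v - toReal w) := by
        rw [← toReal_sub]; exact add_le_add le_rfl (le_weight μ _)

theorem extendFun_add (μ : PseudoNorm) (x y : ℕ →₀ ℝ) :
    extendFun μ (x + y) ≤ extendFun μ x + extendFun μ y := by
  refine le_ciInf_add_ciInf fun v w => ?_
  have h1 := extendFun_le μ (x + y) (v + w)
  have h2 := weight_add μ (x - toReal v) (y - toReal w)
  have h3 : x + y - toReal (v + w) = x - toReal v + (y - toReal w) := by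
    rw [toReal_add]; abel
  rw [h3] at h1
  linarith [map_add_le_add μ v w]

theorem extendFun_zero (μ : PseudoNorm) : extendFun μ 0 = 0 := by
  have h := extendFun_toReal μ 0
  have h0 : toReal 0 = 0 := by ext i; simp [toReal_apply]
  rwa [h0, map_zero] at h

theorem extendFun_ratSMul (μ : PseudoNorm) (q : ℚ) (x : ℕ →₀ ℝ) :
    extendFun μ ((q : ℝ) • x) ≤ |(q : ℝ)| * extendFun μ x := by
  conv_rhs => rw [extendFun]
  rw [Real.mul_iInf_of_nonneg (abs_nonneg _)]
  refine le_ciInf fun v => ?_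
  have h := extendFun_le μ ((q : ℝ) • x) (q • v)
  rw [toReal_smul, ← smul_sub, weight_smul, map_smul_eq_mul, ← Rat.norm_cast_real, Real.norm_eq_abs] at h
  linarith

theorem extendFun_le_weight (μ : PseudoNorm) (x : ℕ →₀ ℝ) : extendFun μ x ≤ weight μ x := by
  have h := extendFun_le μ x 0
  have h0 : toReal 0 = 0 := by ext i; simp [toReal_apply]
  simpa [h0] using h

theorem extendFun_smul (μ : PseudoNorm) (c : ℝ) (x : ℕ →₀ ℝ) :
    extendFun μ (c • x) ≤ ‖c‖ * extendFun μ x := by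
  have hx : 0 ≤ extendFun μ x :=
    le_ciInf fun v => add_nonneg (apply_nonneg μ v) (weight_nonneg μ _)
  have key : ∀ q : ℚ, extendFun μ (c • x)
      ≤ |(q : ℝ)| * extendFun μ x + |c - q| * weight μ x := by
    intro q
    have h : c • x = (q : ℝ) • x + (c - q) • x := by rw [← add_smul]; simp
    calc extendFun μ (c • x) ≤ extendFun μ ((q : ℝ) • x) + extendFun μ ((c - q) • x) := by
          conv_lhs => rw [h]
          exact extendFun_add μ _ _
      _ ≤ _ := by
        refine add_le_add (extendFun_ratSMul μ q x) ?_
        rw [← weight_smul]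
        exact extendFun_le_weight μ _
  have hc : IsClosed {t : ℝ | extendFun μ (c • x)
      ≤ |t| * extendFun μ x + |c - t| * weight μ x} :=
    isClosed_le continuous_const (by fun_prop)
  have h := (Rat.denseRange_cast (𝕜 := ℝ)).induction_on
    (p := fun t => extendFun μ (c • x) ≤ |t| * extendFun μ x + |c - t| * weight μ x) c hc key
  simpa using h

/-- The extension of the pseudonorm `μ` from `V` to `c₀₀`. -/
noncomputable def extend (μ : PseudoNorm) : Seminorm ℝ (ℕ →₀ ℝ) :=
  Seminorm.ofSMulLE (extendFun μ) (extendFun_zero μ) (extendFun_add μ) (extendFun_smul μ)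

theorem extend_toReal (μ : PseudoNorm) (v : V) : extend μ (toReal v) = μ v :=
  extendFun_toReal μ v

/-- The extension is unique. -/
theorem eq_extend (μ : PseudoNorm) (p : Seminorm ℝ (ℕ →₀ ℝ)) (hp : ∀ v, p (toReal v) = μ v) :
    p = extend μ := by
  have hw (p : Seminorm ℝ (ℕ →₀ ℝ)) (hp : ∀ v, p (toReal v) = μ v) (x : ℕ →₀ ℝ) :
      p x ≤ weight μ x := by
    have h1 : p x ≤ ∑ i ∈ x.support, p (Finsupp.single i (x i)) := by
      conv_lhs => rw [← Finsupp.sum_single x, Finsupp.sum]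
      exact Finset.le_sum_of_subadditive p (map_zero p).le (map_add_le_add p) _ _
    refine h1.trans (Finset.sum_le_sum fun i _ => le_of_eq ?_)
    have h2 : Finsupp.single i (x i) = x i • toReal (Finsupp.single i 1) := by
      ext j; simp [toReal]
    rw [h2, map_smul_eq_mul, hp, Real.norm_eq_abs]
  have hle (p r : Seminorm ℝ (ℕ →₀ ℝ)) (hp : ∀ v, p (toReal v) = μ v)
      (hr : ∀ v, r (toReal v) = μ v) (x : ℕ →₀ ℝ) : p x ≤ r x := by
    refine le_of_forall_pos_le_add fun ε hε => ?_
    obtain ⟨v, hv⟩ : ∃ v : V, weight μ (x - toReal v) < ε / 2 := by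
      set S : ℝ := ∑ i ∈ x.support, μ (Finsupp.single i 1) with hS
      have hS0 : 0 ≤ S := Finset.sum_nonneg fun i _ => apply_nonneg μ _
      have hδ : 0 < ε / 2 / (S + 1) := by positivity
      choose q hq using fun i => Rat.denseRange_cast (𝕜 := ℝ) |>.exists_dist_lt (x i) hδ
      refine ⟨Finsupp.onFinset x.support (fun i => if x i = 0 then 0 else q i) (by
        intro i hi; simp at hi ⊢; exact hi.1), ?_⟩
      rw [weight_eq μ _ (s := x.support) (by
        intro i hi
        simp only [Finsupp.mem_support_iff, Finsupp.sub_apply, toReal_apply,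
          Finsupp.onFinset_apply] at hi ⊢
        intro h0
        simp [h0] at hi)]
      calc _ ≤ ∑ i ∈ x.support, (ε / 2 / (S + 1)) * μ (Finsupp.single i 1) := by
            refine Finset.sum_le_sum fun i hi => ?_
            refine mul_le_mul_of_nonneg_right ?_ (apply_nonneg μ _)
            have h0 : x i ≠ 0 := by simpa using hi
            simpa [toReal_apply, h0, Real.dist_eq] using (hq i).le
        _ = (ε / 2 / (S + 1)) * S := by rw [← Finset.mul_sum]
        _ < (ε / 2 / (S + 1)) * (S + 1) := by nlinarith
        _ = ε / 2 := by field_simp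
    have h1 : p x ≤ p (toReal v) + p (x - toReal v) := by
      simpa using map_add_le_add p (toReal v) (x - toReal v)
    have h2 : r (toReal v) ≤ r x + r (x - toReal v) := by
      have := map_sub_le_add r x (x - toReal v)
      simpa using this
    rw [hp] at h1
    rw [hr] at h2
    linarith [hw p hp (x - toReal v), hw r hr (x - toReal v)]
  ext x
  exact le_antisymm (hle _ _ hp (extend_toReal μ) x) (hle _ _ (extend_toReal μ) hp x)

/-- The real vector space `c₀₀`, as a type depending on `μ` that carries the pseudonorm `μ`. -/
def C00 (_μ : PseudoNorm) : Type := ℕ →₀ ℝ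

noncomputable instance (μ : PseudoNorm) : AddCommGroup (C00 μ) :=
  inferInstanceAs (AddCommGroup (ℕ →₀ ℝ))

noncomputable instance (μ : PseudoNorm) : Module ℝ (C00 μ) :=
  inferInstanceAs (Module ℝ (ℕ →₀ ℝ))

noncomputable instance (μ : PseudoNorm) : SeminormedAddCommGroup (C00 μ) :=
  AddGroupSeminorm.toSeminormedAddCommGroup (E := C00 μ) (extend μ).toAddGroupSeminorm

noncomputable instance (μ : PseudoNorm) : NormedSpace ℝ (C00 μ) where
  norm_smul_le c x := (map_smul_eq_mul (extend μ) c x).le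

/-- The Banach space `X_μ`: the Hausdorff completion of `(c₀₀, μ)`, that is, the completion of the
quotient of `(c₀₀, μ)` by the null space of `μ`. -/
abbrev X (μ : PseudoNorm) : Type := UniformSpace.Completion (C00 μ)

/-- The set of pseudonorms `μ` for which `X_μ` is infinite-dimensional. -/
def PInf : Set PseudoNorm := {μ | ¬ FiniteDimensional ℝ (X μ)}

/-- The set of those `μ ∈ PInf` whose extension to `c₀₀` is an actual norm. -/
def B : Set PseudoNorm := {μ | μ ∈ PInf ∧ ∀ x : ℕ →₀ ℝ, extend μ x = 0 → x = 0}

/-- The isometry class of `Z` in the topological subspace `I` of the space of pseudonorms. -/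
def isometryClass (I : Set PseudoNorm) (Z : Type*) [NormedAddCommGroup Z] [NormedSpace ℝ Z] :
    Set I :=
  {μ | Nonempty (X (μ : PseudoNorm) ≃ₗᵢ[ℝ] Z)}

/-- Every separable Banach space embeds linearly isometrically into `Z`. (Every separable Banach
space is isometric to one that lives in `Type`.) -/
def IsometricallyUniversal (Z : Type*) [NormedAddCommGroup Z] [NormedSpace ℝ Z] : Prop :=
  ∀ (Y : Type) [NormedAddCommGroup Y] [NormedSpace ℝ Y] [CompleteSpace Y] [SeparableSpace Y],
    Nonempty (Y →ₗᵢ[ℝ] Z)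

/-- `f` is a (not necessarily surjective) `K`-isomorphism. -/
def IsKIsomorphism {E F : Type*} [NormedAddCommGroup E] [NormedSpace ℝ E]
    [NormedAddCommGroup F] [NormedSpace ℝ F] (K : ℝ) (f : E →L[ℝ] F) : Prop :=
  ∀ x, K⁻¹ * ‖x‖ ≤ ‖f x‖ ∧ ‖f x‖ ≤ K * ‖x‖

/-- `G` is a Gurariĭ space: a separable Banach space such that for every `ε > 0` and every
isometric embedding `g : A → F` of a subspace `A` of `G` into a finite-dimensional Banach space
`F` there is a `(1 + ε)`-isomorphism `f : F → G` with `‖f ∘ g - id_A‖ ≤ ε`. -/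
structure IsGurarii (G : Type*) [NormedAddCommGroup G] [NormedSpace ℝ G] : Prop where
  complete : CompleteSpace G
  separable : SeparableSpace G
  extension : ∀ ε : ℝ, 0 < ε → ∀ (A : Submodule ℝ G) (F : Type) [NormedAddCommGroup F]
    [NormedSpace ℝ F] [FiniteDimensional ℝ F] (g : A →ₗᵢ[ℝ] F),
    ∃ f : F →L[ℝ] G, IsKIsomorphism (1 + ε) f ∧
      ‖f.comp g.toContinuousLinearMap - A.subtypeL‖ ≤ ε

/-- `A` is `G_δ`-hard: every `G_δ` subset of every zero-dimensional Polish space `Y` is the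
preimage of `A` under a continuous map. (Every Polish space is homeomorphic to one that lives in
`Type`.) -/
def IsGδHard {S : Type*} [TopologicalSpace S] (A : Set S) : Prop :=
  ∀ (Y : Type) [TopologicalSpace Y] [PolishSpace Y],
    IsTopologicalBasis {U : Set Y | IsClopen U} →
    ∀ D : Set Y, IsGδ D → ∃ f : Y → S, Continuous f ∧ f ⁻¹' A = D

/-- `A` is `G_δ`-complete: it is a `G_δ` set and `G_δ`-hard. -/
def IsGδComplete {S : Type*} [TopologicalSpace S] (A : Set S) : Prop :=
  IsGδ A ∧ IsGδHard A

end BanachCoding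

/-! Pseudonorms are compared on initial segments: `Close n ε p q` bounds their difference on the
first `n` coordinates by `ε` times the `ℓ₁`-norm. These relations describe the topology
(`close_mem_nhds`, `exists_close_subset`).

The engine is amalgamation (`exists_amalgam`): two pseudonorms that are close along a finite piece
live in one pseudonorm, where the two copies of the piece are close as vectors. In a Gurariĭ space
this gives `IsGurarii.exists_close`: a pseudonorm known up to `δ` on `n` vectors is realized up to
any `ε` on `m ≥ n` vectors, after moving the given ones by at most `δ + ε`. Iterating with errors
`(1 / 2) ^ k` yields universality, and alternating between two Gurariĭ spaces yields uniqueness.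

For `X μ`, being Gurariĭ amounts to countably many open conditions on `μ` (`mem_gurariiSet_iff`), so
by uniqueness the isometry class is `G_δ`. Each condition is dense in the Polish space `B`:
amalgamate, then add a small multiple of `l1` to obtain a norm. Baire's theorem gives existence and
shows that the class is dense in `B`.

If `Z` is universal, its class is dense in `B` as well: embed `X μ` into `Z` and continue finitely
many basis images to an independent sequence with dense range. If that class is also `G_δ`, the two
dense `G_δ` sets meet, so `Z` is isometric to the Gurariĭ space.

For hardness, the complement of the class is dense in `B`, since an `ℓ₁`-tail destroys the Gurariĭ
property, and a dense `G_δ` set with dense complement in a Polish space is `G_δ`-hard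
(`isGδHard_of_dense`). The statements for `PInf` follow through the inclusion of `B`. -/

namespace BanachCoding

/-! ### Pseudonorms induced by sequences, and closeness on initial segments -/

section Basics

/-- The `ℓ₁`-norm on `V`. -/
noncomputable def l1Fun (v : V) : ℝ := v.sum fun _ q => |(q : ℝ)|

theorem l1Fun_eq (v : V) {s : Finset ℕ} (h : v.support ⊆ s) :
    l1Fun v = ∑ i ∈ s, |(v i : ℝ)| :=
  Finsupp.sum_of_support_subset v h _ (by simp)

/-- The `ℓ₁`-norm on `V`, as a pseudonorm. -/
noncomputable def l1 : PseudoNorm :=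
  Seminorm.of l1Fun
    (fun v w => by
      classical
      rw [l1Fun_eq (v + w) Finsupp.support_add,
        l1Fun_eq v (Finset.subset_union_left (s₂ := w.support)),
        l1Fun_eq w (Finset.subset_union_right (s₁ := v.support)), ← Finset.sum_add_distrib]
      refine Finset.sum_le_sum fun i _ => ?_
      rw [Finsupp.add_apply, Rat.cast_add]
      exact abs_add_le _ _)
    (fun q v => by
      rw [l1Fun_eq (q • v) Finsupp.support_smul, l1Fun_eq v subset_rfl, Finset.mul_sum,
        ← Rat.norm_cast_real, Real.norm_eq_abs]
      exact Finset.sum_congr rfl fun i _ => by simp [abs_mul])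

theorem l1_eq (v : V) {s : Finset ℕ} (h : v.support ⊆ s) : l1 v = ∑ i ∈ s, |(v i : ℝ)| :=
  l1Fun_eq v h

/-- The vector `v` is a combination of the first `n` unit vectors. -/
def SuppLT (n : ℕ) (v : V) : Prop := ∀ i, n ≤ i → v i = 0

theorem SuppLT.mono {n m : ℕ} (h : n ≤ m) {v : V} (hv : SuppLT n v) : SuppLT m v :=
  fun i hi => hv i (h.trans hi)

theorem SuppLT.support_subset {n : ℕ} {v : V} (hv : SuppLT n v) :
    v.support ⊆ Finset.range n := by
  intro i hi
  by_contra h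
  exact (Finsupp.mem_support_iff.1 hi) (hv i (by simpa using h))

theorem SuppLT.l1_eq {n : ℕ} {v : V} (hv : SuppLT n v) :
    l1 v = ∑ i ∈ Finset.range n, |(v i : ℝ)| :=
  BanachCoding.l1_eq v hv.support_subset

theorem SuppLT.add {n : ℕ} {v w : V} (hv : SuppLT n v) (hw : SuppLT n w) : SuppLT n (v + w) :=
  fun i hi => by simp [hv i hi, hw i hi]

theorem SuppLT.sub {n : ℕ} {v w : V} (hv : SuppLT n v) (hw : SuppLT n w) : SuppLT n (v - w) :=
  fun i hi => by simp [hv i hi, hw i hi]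

theorem SuppLT.smul {n : ℕ} {v : V} (hv : SuppLT n v) (q : ℚ) : SuppLT n (q • v) :=
  fun i hi => by simp [hv i hi]

theorem suppLT_single {n i : ℕ} (h : i < n) (q : ℚ) : SuppLT n (Finsupp.single i q) :=
  fun j hj => by rw [Finsupp.single_apply, if_neg (by omega)]

theorem exists_suppLT (v : V) : ∃ n, SuppLT n v := by
  refine ⟨v.support.sup id + 1, fun i hi => ?_⟩
  by_contra h
  have := Finset.le_sup (f := id) (Finsupp.mem_support_iff.2 h)
  simp only [id] at this
  omega

theorem exists_trunc (n : ℕ) (q : ℕ → ℚ) : ∃ v : V, SuppLT n v ∧ ∀ i < n, v i = q i :=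
  ⟨Finsupp.onFinset (Finset.range n) (fun i => if i < n then q i else 0)
    (by simp +contextual), fun i hi => by simp [not_lt.2 hi], fun i hi => by simp [hi]⟩

theorem l1_single (i : ℕ) (q : ℚ) : l1 (Finsupp.single i q) = |(q : ℝ)| := by
  change l1Fun _ = _
  simp [l1Fun]

/-- `p` and `q` differ by at most `ε` times the `ℓ₁`-norm on the first `n` coordinates. -/
def Close (n : ℕ) (ε : ℝ) (p q : PseudoNorm) : Prop :=
  ∀ v : V, SuppLT n v → |p v - q v| ≤ ε * l1 v

theorem Close.symm {n : ℕ} {ε : ℝ} {p q : PseudoNorm} (h : Close n ε p q) : Close n ε q p :=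
  fun v hv => by rw [abs_sub_comm]; exact h v hv

theorem Close.trans {n : ℕ} {ε δ : ℝ} {p q r : PseudoNorm} (h : Close n ε p q)
    (h' : Close n δ q r) : Close n (ε + δ) p r := fun v hv => by
  have := abs_sub_le (p v) (q v) (r v)
  linarith [h v hv, h' v hv]

theorem Close.mono {n m : ℕ} {ε δ : ℝ} {p q : PseudoNorm} (h : Close n ε p q)
    (hm : m ≤ n) (hε : ε ≤ δ) : Close m δ p q := fun v hv =>
  (h v (hv.mono hm)).trans (mul_le_mul_of_nonneg_right hε (apply_nonneg l1 v))

theorem Close.refl (n : ℕ) (p : PseudoNorm) : Close n 0 p p := fun v _ => by simp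

/-- The pseudonorm on `V` induced by a sequence in a normed space. -/
noncomputable def normSeq {Z : Type*} [NormedAddCommGroup Z] [NormedSpace ℝ Z] (z : ℕ → Z) :
    PseudoNorm :=
  Seminorm.of (fun v => ‖Finsupp.linearCombination ℝ z (toReal v)‖)
    (fun v w => by rw [toReal_add, map_add]; exact norm_add_le _ _)
    (fun q v => by
      rw [toReal_smul, map_smul, norm_smul, ← Rat.norm_cast_real])

variable {Z W : Type*} [NormedAddCommGroup Z] [NormedSpace ℝ Z] [NormedAddCommGroup W]
  [NormedSpace ℝ W]

theorem normSeq_apply (z : ℕ → Z) (v : V) :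
    normSeq z v = ‖Finsupp.linearCombination ℝ z (toReal v)‖ := rfl

theorem SuppLT.lc_eq {n : ℕ} {v : V} (hv : SuppLT n v) (z : ℕ → Z) :
    Finsupp.linearCombination ℝ z (toReal v) = ∑ i ∈ Finset.range n, (v i : ℝ) • z i := by
  rw [Finsupp.linearCombination_apply, Finsupp.sum_of_support_subset (s := Finset.range n)]
  · simp [toReal_apply]
  · exact (Finsupp.support_mapRange).trans hv.support_subset
  · simp

theorem toReal_single (i : ℕ) (q : ℚ) :
    toReal (Finsupp.single i q) = Finsupp.single i (q : ℝ) := by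
  simp [toReal]

theorem normSeq_single (z : ℕ → Z) (i : ℕ) : normSeq z (Finsupp.single i 1) = ‖z i‖ := by
  simp [normSeq_apply, toReal_single]

theorem normSeq_comp (φ : Z →ₗᵢ[ℝ] W) (z : ℕ → Z) : normSeq (fun i => φ (z i)) = normSeq z := by
  ext v
  obtain ⟨n, hn⟩ := exists_suppLT v
  rw [normSeq_apply, normSeq_apply, hn.lc_eq, hn.lc_eq, ← φ.norm_map]
  simp

theorem close_normSeq {n : ℕ} {δ : ℝ} {z w : ℕ → Z} (h : ∀ i < n, ‖z i - w i‖ ≤ δ) :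
    Close n δ (normSeq z) (normSeq w) := fun v hv => by
  rw [normSeq_apply, normSeq_apply, hv.lc_eq, hv.lc_eq, hv.l1_eq]
  refine (abs_norm_sub_norm_le _ _).trans ?_
  rw [← Finset.sum_sub_distrib, Finset.mul_sum]
  refine norm_sum_le_of_le _ fun i hi => ?_
  rw [← smul_sub, norm_smul, Real.norm_eq_abs, mul_comm]
  exact mul_le_mul_of_nonneg_right (h i (Finset.mem_range.1 hi)) (abs_nonneg _)

/-- Closeness of the induced pseudonorms bounds the norms of all real combinations. -/
theorem Close.real {n : ℕ} {δ : ℝ} {z : ℕ → Z} {w : ℕ → W}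
    (h : Close n δ (normSeq z) (normSeq w)) (x : ℕ → ℝ) :
    |‖∑ i ∈ Finset.range n, x i • z i‖ - ‖∑ i ∈ Finset.range n, x i • w i‖|
      ≤ δ * ∑ i ∈ Finset.range n, |x i| := by
  have hd : DenseRange fun (q : ℕ → ℚ) (i : ℕ) => (q i : ℝ) :=
    DenseRange.piMap fun _ => Rat.denseRange_cast
  refine hd.induction_on (p := fun x : ℕ → ℝ =>
    |‖∑ i ∈ Finset.range n, x i • z i‖ - ‖∑ i ∈ Finset.range n, x i • w i‖|
      ≤ δ * ∑ i ∈ Finset.range n, |x i|) x ?_ fun q => ?_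
  · exact isClosed_le (by fun_prop) (by fun_prop)
  · obtain ⟨v, hs, e⟩ := exists_trunc n q
    have := h v hs
    rw [normSeq_apply, normSeq_apply, hs.lc_eq, hs.lc_eq, hs.l1_eq] at this
    have e1 : ∑ i ∈ Finset.range n, (v i : ℝ) • z i = ∑ i ∈ Finset.range n, (q i : ℝ) • z i :=
      Finset.sum_congr rfl fun i hi => by rw [e i (Finset.mem_range.1 hi)]
    have e2 : ∑ i ∈ Finset.range n, (v i : ℝ) • w i = ∑ i ∈ Finset.range n, (q i : ℝ) • w i :=
      Finset.sum_congr rfl fun i hi => by rw [e i (Finset.mem_range.1 hi)]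
    have e3 : ∑ i ∈ Finset.range n, |(v i : ℝ)| = ∑ i ∈ Finset.range n, |(q i : ℝ)| :=
      Finset.sum_congr rfl fun i hi => by rw [e i (Finset.mem_range.1 hi)]
    rwa [e1, e2, e3] at this

/-- A lower `ℓ₁`-bound on rational combinations passes to real ones. -/
theorem le_norm_real {n : ℕ} {c : ℝ} {z : ℕ → Z}
    (h : ∀ v : V, SuppLT n v → c * l1 v ≤ normSeq z v) (x : ℕ → ℝ) :
    c * ∑ i ∈ Finset.range n, |x i| ≤ ‖∑ i ∈ Finset.range n, x i • z i‖ := by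
  have hd : DenseRange fun (q : ℕ → ℚ) (i : ℕ) => (q i : ℝ) :=
    DenseRange.piMap fun _ => Rat.denseRange_cast
  refine hd.induction_on (p := fun x : ℕ → ℝ =>
    c * ∑ i ∈ Finset.range n, |x i| ≤ ‖∑ i ∈ Finset.range n, x i • z i‖) x ?_ fun q => ?_
  · exact isClosed_le (by fun_prop) (by fun_prop)
  · obtain ⟨v, hs, e⟩ := exists_trunc n q
    have := h v hs
    rw [normSeq_apply, hs.lc_eq, hs.l1_eq] at this
    have e1 : ∑ i ∈ Finset.range n, (v i : ℝ) • z i = ∑ i ∈ Finset.range n, (q i : ℝ) • z i :=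
      Finset.sum_congr rfl fun i hi => by rw [e i (Finset.mem_range.1 hi)]
    have e3 : ∑ i ∈ Finset.range n, |(v i : ℝ)| = ∑ i ∈ Finset.range n, |(q i : ℝ)| :=
      Finset.sum_congr rfl fun i hi => by rw [e i (Finset.mem_range.1 hi)]
    rwa [e1, e3] at this

end Basics

/-! ### The Banach space of a pseudonorm -/

section Space

/-- The image in `X μ` of the `i`-th unit vector of `c₀₀`. -/
noncomputable def E (μ : PseudoNorm) (i : ℕ) : X μ :=
  ((show C00 μ from (Finsupp.single i 1 : ℕ →₀ ℝ)) : C00 μ)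

theorem lc_E (μ : PseudoNorm) (x : ℕ →₀ ℝ) :
    Finsupp.linearCombination ℝ (E μ) x = ((show C00 μ from x : C00 μ) : X μ) := by
  have h : Finsupp.linearCombination ℝ (E μ) =
      (UniformSpace.Completion.toComplL (𝕜 := ℝ) (E := C00 μ)).toLinearMap ∘ₗ
        (LinearMap.id : (ℕ →₀ ℝ) →ₗ[ℝ] (ℕ →₀ ℝ)) := by
    refine Finsupp.lhom_ext' fun i => LinearMap.ext_ring ?_
    simp [E]
    rfl
  rw [h]
  rfl

theorem norm_lc_E (μ : PseudoNorm) (x : ℕ →₀ ℝ) :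
    ‖Finsupp.linearCombination ℝ (E μ) x‖ = extend μ x := by
  rw [lc_E, UniformSpace.Completion.norm_coe]
  rfl

theorem normSeq_E (μ : PseudoNorm) : normSeq (E μ) = μ := by
  ext v
  rw [normSeq_apply, norm_lc_E, extend_toReal]

theorem norm_E (μ : PseudoNorm) (i : ℕ) : ‖E μ i‖ = μ (Finsupp.single i 1) := by
  rw [← normSeq_single, normSeq_E]

/-- The image of a vector of `V` in `X μ`. -/
noncomputable def coeX (μ : PseudoNorm) (v : V) : X μ :=
  Finsupp.linearCombination ℝ (E μ) (toReal v)

theorem norm_coeX (μ : PseudoNorm) (v : V) : ‖coeX μ v‖ = μ v := by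
  rw [coeX, ← normSeq_apply, normSeq_E]

theorem coeX_sub (μ : PseudoNorm) (v w : V) : coeX μ (v - w) = coeX μ v - coeX μ w := by
  rw [coeX, toReal_sub, map_sub]; rfl

theorem coeX_add (μ : PseudoNorm) (v w : V) : coeX μ (v + w) = coeX μ v + coeX μ w := by
  rw [coeX, toReal_add, map_add]; rfl

theorem coeX_single (μ : PseudoNorm) (i : ℕ) : coeX μ (Finsupp.single i 1) = E μ i := by
  simp [coeX, toReal_single]

theorem toReal_linearCombination (g : ℕ → V) (v : V) {n : ℕ} (hv : SuppLT n v) :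
    toReal (Finsupp.linearCombination ℚ g v) =
      ∑ i ∈ Finset.range n, (v i : ℝ) • toReal (g i) := by
  rw [Finsupp.linearCombination_apply,
    Finsupp.sum_of_support_subset v hv.support_subset _ (by simp)]
  ext j
  simp [toReal_apply, Finsupp.finsetSum_apply]

/-- Pulling back along a sequence of vectors of `V`. -/
noncomputable def pull (μ : PseudoNorm) (g : ℕ → V) : PseudoNorm :=
  μ.comp (Finsupp.linearCombination ℚ g)

theorem pull_apply (μ : PseudoNorm) (g : ℕ → V) (v : V) :
    pull μ g v = μ (Finsupp.linearCombination ℚ g v) := rfl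

theorem pull_eq (μ : PseudoNorm) (g : ℕ → V) : pull μ g = normSeq fun i => coeX μ (g i) := by
  ext v
  obtain ⟨n, hn⟩ := exists_suppLT v
  rw [pull_apply, normSeq_apply, hn.lc_eq, ← norm_coeX, coeX, toReal_linearCombination g v hn]
  simp [coeX]

/-- The image of `V` is dense in `X μ`. -/
theorem denseRange_coeX (μ : PseudoNorm) : DenseRange (coeX μ) := by
  have h1 : ∀ x : ℕ →₀ ℝ, Finsupp.linearCombination ℝ (E μ) x ∈ closure (range (coeX μ)) := by
    intro x
    induction x using Finsupp.induction_linear with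
    | zero => exact subset_closure ⟨0, by simp [coeX, show toReal 0 = 0 by ext; simp [toReal]]⟩
    | add x y hx hy =>
      rw [map_add]
      refine map_mem_closure₂ continuous_add hx hy ?_
      rintro _ ⟨v, rfl⟩ _ ⟨w, rfl⟩
      exact ⟨v + w, coeX_add μ v w⟩
    | single i t =>
      rw [Finsupp.linearCombination_single]
      refine (Rat.denseRange_cast (𝕜 := ℝ)).induction_on
        (p := fun t => t • E μ i ∈ closure (range (coeX μ))) t ?_ fun q => ?_
      · exact isClosed_closure.preimage (f := fun t : ℝ => t • E μ i) (by fun_prop)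
      · exact subset_closure ⟨Finsupp.single i q, by simp [coeX, toReal_single]⟩
  intro x
  refine UniformSpace.Completion.induction_on x isClosed_closure fun a => ?_
  exact lc_E μ a ▸ h1 a

instance (μ : PseudoNorm) : SeparableSpace (X μ) :=
  ⟨range (coeX μ), countable_range _, denseRange_coeX μ⟩

theorem exists_coeX_near {μ : PseudoNorm} (x : X μ) {ε : ℝ} (hε : 0 < ε) :
    ∃ v, ‖coeX μ v - x‖ < ε := by
  obtain ⟨v, hv⟩ := (denseRange_coeX μ).exists_dist_lt x hε
  exact ⟨v, by rwa [← dist_eq_norm, dist_comm]⟩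

variable {Z : Type*} [NormedAddCommGroup Z] [NormedSpace ℝ Z]

/-- By uniqueness of the extension to `c₀₀`, agreement on rational combinations forces agreement on
real ones; the resulting isometry then extends to the completion. -/
theorem exists_linearIsometry [CompleteSpace Z] {μ : PseudoNorm} {z : ℕ → Z}
    (h : normSeq z = μ) : ∃ φ : X μ →ₗᵢ[ℝ] Z, ∀ i, φ (E μ i) = z i := by
  have h1 : (normSeminorm ℝ Z).comp (Finsupp.linearCombination ℝ z) = extend μ :=
    eq_extend μ _ fun v => by rw [← h]; rfl
  let L : C00 μ →ₗᵢ[ℝ] Z :=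
    { toLinearMap := (Finsupp.linearCombination ℝ z : (ℕ →₀ ℝ) →ₗ[ℝ] Z)
      norm_map' := fun x => DFunLike.congr_fun h1 x }
  have hd : DenseRange (UniformSpace.Completion.toComplL (𝕜 := ℝ) (E := C00 μ)) :=
    UniformSpace.Completion.denseRange_coe
  have hi : IsUniformInducing (UniformSpace.Completion.toComplL (𝕜 := ℝ) (E := C00 μ)) :=
    UniformSpace.Completion.isUniformInducing_coe _
  let φ : X μ →L[ℝ] Z :=
    L.toContinuousLinearMap.extend (UniformSpace.Completion.toComplL (𝕜 := ℝ) (E := C00 μ))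
  have hφ : ∀ a : C00 μ, φ (a : X μ) = L a := fun a =>
    ContinuousLinearMap.extend_eq L.toContinuousLinearMap hd hi a
  refine ⟨{ toLinearMap := φ.toLinearMap, norm_map' := fun x => ?_ }, fun i => ?_⟩
  · refine UniformSpace.Completion.induction_on x ?_ fun a => ?_
    · exact isClosed_eq (φ.continuous.norm) continuous_norm
    · change ‖φ (a : X μ)‖ = _
      rw [hφ, L.norm_map, UniformSpace.Completion.norm_coe]
  · change φ _ = _
    rw [E, hφ]
    change Finsupp.linearCombination ℝ z (Finsupp.single i 1) = _
    simp

theorem nonempty_equiv [CompleteSpace Z] {μ : PseudoNorm} {z : ℕ → Z}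
    (h : normSeq z = μ) (hd : DenseRange z) : Nonempty (X μ ≃ₗᵢ[ℝ] Z) := by
  obtain ⟨φ, hφ⟩ := exists_linearIsometry h
  refine ⟨LinearIsometryEquiv.ofSurjective φ ?_⟩
  have hc : IsClosed (range φ) := φ.isometry.isClosedEmbedding.isClosed_range
  have h2 : range z ⊆ range φ := by
    rintro _ ⟨i, rfl⟩
    exact ⟨_, hφ i⟩
  intro y
  exact closure_minimal h2 hc (hd y)

end Space

/-! ### The topology on pseudonorms; `B` is Polish -/

section Topology

open Filter Topology

theorem continuous_eval (v : V) : Continuous fun μ : PseudoNorm => μ v :=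
  (continuous_apply v).comp continuous_induced_dom

theorem isEmbedding_coe : IsEmbedding fun (μ : PseudoNorm) (v : V) => μ v :=
  ⟨⟨rfl⟩, DFunLike.coe_injective⟩

theorem isClosedEmbedding_coe : IsClosedEmbedding fun (μ : PseudoNorm) (v : V) => μ v := by
  refine ⟨isEmbedding_coe, ?_⟩
  have : (range fun (μ : PseudoNorm) (v : V) => μ v) =
      (⋂ (v) (w), {f : V → ℝ | f (v + w) ≤ f v + f w}) ∩
        ⋂ (q : ℚ) (v), {f : V → ℝ | f (q • v) = ‖q‖ * f v} := by
    ext f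
    simp only [mem_inter_iff, mem_iInter, mem_ofPred_eq]
    constructor
    · rintro ⟨μ, rfl⟩
      exact ⟨map_add_le_add μ, map_smul_eq_mul μ⟩
    · rintro ⟨h1, h2⟩
      exact ⟨Seminorm.of f h1 h2, rfl⟩
  rw [this]
  refine IsClosed.inter ?_ ?_
  · exact isClosed_iInter fun v => isClosed_iInter fun w =>
      isClosed_le (continuous_apply _) (by fun_prop)
  · exact isClosed_iInter fun q => isClosed_iInter fun v =>
      isClosed_eq (continuous_apply _) (continuous_const.mul (continuous_apply _))

instance : PolishSpace PseudoNorm := isClosedEmbedding_coe.polishSpace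

theorem apply_le_mul_l1 (μ : PseudoNorm) {n : ℕ} {M : ℝ}
    (h : ∀ i < n, μ (Finsupp.single i 1) ≤ M) {v : V} (hv : SuppLT n v) : μ v ≤ M * l1 v := by
  have e : v = ∑ i ∈ Finset.range n, v i • (Finsupp.single i 1 : V) := by
    conv_lhs => rw [← Finsupp.sum_single v,
      Finsupp.sum_of_support_subset v hv.support_subset _ (by simp)]
    simp
  conv_lhs => rw [e]
  rw [hv.l1_eq, Finset.mul_sum]
  refine (Finset.le_sum_of_subadditive μ (map_zero μ).le (map_add_le_add μ) _ _).trans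
    (Finset.sum_le_sum fun i hi => ?_)
  rw [map_smul_eq_mul, ← Rat.norm_cast_real, Real.norm_eq_abs, mul_comm]
  exact mul_le_mul_of_nonneg_right (h i (Finset.mem_range.1 hi)) (abs_nonneg _)

theorem l1_pos {v : V} (hv : v ≠ 0) : 0 < l1 v := by
  obtain ⟨i, hi⟩ := Finsupp.ne_iff.1 hv
  rw [l1_eq v subset_rfl]
  exact Finset.sum_pos' (fun _ _ => abs_nonneg _)
    ⟨i, by simpa using hi, abs_pos.2 (by simpa using hi)⟩

theorem exists_rat_l1 (v : V) : ∃ q : ℚ, (q : ℝ) = l1 v :=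
  ⟨∑ i ∈ v.support, |v i|, by rw [l1_eq v subset_rfl]; push_cast; rfl⟩

/-- Only rational scalars act on `V`, but normalization is still possible because the `ℓ₁`-norm of a
rational vector is rational. -/
theorem close_of_le_one {n : ℕ} {ε : ℝ} {μ ν : PseudoNorm}
    (h : ∀ v, SuppLT n v → l1 v ≤ 1 → |μ v - ν v| ≤ ε) : Close n ε μ ν := fun v hv => by
  rcases eq_or_ne v 0 with rfl | h0
  · simp
  obtain ⟨q, hq⟩ := exists_rat_l1 v
  have hq0 : (0 : ℝ) < q := hq ▸ l1_pos h0
  have hn : ‖q⁻¹‖ = (q : ℝ)⁻¹ := by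
    rw [← Rat.norm_cast_real, Real.norm_eq_abs, Rat.cast_inv, abs_of_pos (inv_pos.2 hq0)]
  have := h (q⁻¹ • v) (hv.smul _) (by
    rw [map_smul_eq_mul, hn, ← hq, inv_mul_cancel₀ hq0.ne'])
  rw [map_smul_eq_mul, map_smul_eq_mul, hn, ← mul_sub, abs_mul, abs_of_pos (inv_pos.2 hq0),
    inv_mul_le_iff₀ hq0, mul_comm, hq] at this
  exact this

theorem exists_finite_net (n : ℕ) {η : ℝ} (hη : 0 < η) : ∃ t : Set V, t.Finite ∧
    (∀ w ∈ t, SuppLT n w) ∧ ∀ v, SuppLT n v → l1 v ≤ 1 → ∃ w ∈ t, l1 (v - w) ≤ n * η := by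
  let φ : V → Fin n → ℝ := fun v i => v i
  let T : Set V := {v | SuppLT n v ∧ l1 v ≤ 1}
  have hb : TotallyBounded (φ '' T) := by
    refine TotallyBounded.subset ?_
      (ProperSpace.isCompact_closedBall (0 : Fin n → ℝ) 1).totallyBounded
    rintro _ ⟨v, ⟨hv, hv1⟩, rfl⟩
    rw [mem_closedBall_zero_iff, pi_norm_le_iff_of_nonneg zero_le_one]
    intro i
    refine le_trans ?_ hv1
    rw [hv.l1_eq, Real.norm_eq_abs]
    exact Finset.single_le_sum (f := fun i => |(v i : ℝ)|) (fun _ _ => abs_nonneg _)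
      (Finset.mem_range.2 i.2)
  obtain ⟨t, ht, htf, hc⟩ := Metric.finite_approx_of_totallyBounded hb η hη
  obtain ⟨t', ht', htf', rfl⟩ := (exists_subset_image_finite_and
    (p := fun s => s = t)).1 ⟨t, ht, htf, rfl⟩
  refine ⟨t', htf', fun w hw => (ht' hw).1, fun v hv hv1 => ?_⟩
  have := hc ⟨v, ⟨hv, hv1⟩, rfl⟩
  simp only [mem_iUnion, mem_image, exists_prop] at this
  obtain ⟨_, ⟨w, hw, rfl⟩, hd⟩ := this
  refine ⟨w, hw, ?_⟩
  rw [(hv.sub (ht' hw).1).l1_eq]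
  refine (Finset.sum_le_card_nsmul _ _ η fun i hi => ?_).trans (by simp)
  have := (dist_le_pi_dist (φ v) (φ w) ⟨i, Finset.mem_range.1 hi⟩).trans hd.le
  simpa [φ, Real.dist_eq] using this

theorem close_mem_nhds (n : ℕ) {ε : ℝ} (hε : 0 < ε) (μ : PseudoNorm) :
    {ν | Close n ε μ ν} ∈ 𝓝 μ := by
  -- `M` bounds both `μ` and any `ν` that exceeds `μ` by less than 1 on the first `n` unit vectors,
  -- so both are `M`-Lipschitz for `l1` there. The mesh makes each of them vary by at most `ε / 4`
  -- between a point and the net; the net values contribute `ε / 2`.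
  set M : ℝ := ∑ i ∈ Finset.range n, μ (Finsupp.single i 1) + 1 with hM
  have hs : ∀ i < n, μ (Finsupp.single i 1) + 1 ≤ M := fun i hi => by
    have := Finset.single_le_sum (f := fun i => μ (Finsupp.single i 1))
      (fun _ _ => apply_nonneg μ _) (Finset.mem_range.2 hi)
    linarith
  have hM0 : 0 < M := by
    have : 0 ≤ ∑ i ∈ Finset.range n, μ (Finsupp.single i 1) :=
      Finset.sum_nonneg fun _ _ => apply_nonneg μ _
    linarith
  obtain ⟨t, htf, hts, ht⟩ := exists_finite_net n (η := ε / (4 * M * (n + 1))) (by positivity)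
  have e1 : ∀ᶠ ν : PseudoNorm in 𝓝 μ, ∀ w ∈ t, |μ w - ν w| < ε / 2 := by
    refine (eventually_all_finite htf).2 fun w _ => ?_
    have hc : Continuous fun ν : PseudoNorm => |μ w - ν w| :=
      (continuous_const.sub (continuous_eval w)).abs
    exact hc.continuousAt.eventually_lt (continuousAt_const (y := ε / 2)) (by simpa using hε)
  have e2 : ∀ᶠ ν : PseudoNorm in 𝓝 μ, ∀ i ∈ Finset.range n,
      ν (Finsupp.single i 1) < μ (Finsupp.single i 1) + 1 := by
    refine (Finset.eventually_all _).2 fun i _ => ?_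
    exact (continuous_eval _).continuousAt.eventually_lt
      (continuousAt_const (y := μ (Finsupp.single i 1) + 1)) (by linarith)
  filter_upwards [e1, e2] with ν h1 h2
  refine close_of_le_one fun v hv hv1 => ?_
  obtain ⟨w, hw, hvw⟩ := ht v hv hv1
  have a1 := apply_le_mul_l1 μ (fun i hi => by linarith [hs i hi]) (hv.sub (hts w hw)) (M := M)
  have a2 := apply_le_mul_l1 ν (fun i hi => by
    linarith [hs i hi, h2 i (Finset.mem_range.2 hi)]) (hv.sub (hts w hw)) (M := M)
  have a3 : M * l1 (v - w) ≤ ε / 4 := by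
    calc M * l1 (v - w) ≤ M * (n * (ε / (4 * M * (n + 1)))) := by gcongr
      _ = ε / 4 * (n / (n + 1)) := by field_simp
      _ ≤ ε / 4 * 1 := by
        gcongr
        rw [div_le_one (by positivity)]
        linarith
      _ = ε / 4 := mul_one _
  have b1 := abs_sub_map_le_sub μ v w
  have b2 := abs_sub_map_le_sub ν v w
  have b3 := h1 w hw
  rw [abs_le] at *
  rw [abs_lt] at b3
  constructor <;> linarith [b1.1, b1.2, b2.1, b2.2, b3.1, b3.2]

theorem exists_close_subset {μ : PseudoNorm} {U : Set PseudoNorm} (hU : U ∈ 𝓝 μ) :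
    ∃ n, ∃ ε > 0, ∀ ν, Close n ε μ ν → ν ∈ U := by
  rw [nhds_induced, nhds_pi, mem_comap] at hU
  obtain ⟨T, hT, hTU⟩ := hU
  obtain ⟨I, hI, t, ht, hIt⟩ := Filter.mem_pi.1 hT
  suffices H : ∃ n, ∃ ε > 0, ∀ ν, Close n ε μ ν → ∀ v ∈ I, ν v ∈ t v by
    obtain ⟨n, ε, hε, h⟩ := H
    exact ⟨n, ε, hε, fun ν hν => hTU (hIt (h ν hν))⟩
  clear hIt
  induction I, hI using Set.Finite.induction_on with
  | empty => exact ⟨0, 1, one_pos, by simp⟩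
  | @insert v I _ _ ih =>
    obtain ⟨n, ε, hε, h⟩ := ih
    obtain ⟨k, hk⟩ := exists_suppLT v
    obtain ⟨δ, hδ, hδt⟩ := Metric.mem_nhds_iff.1 (ht v)
    have hl : 0 ≤ l1 v := apply_nonneg _ _
    refine ⟨max n k, min ε (δ / (l1 v + 1)), lt_min hε (by positivity), fun ν hν => ?_⟩
    intro w hw
    rcases hw with rfl | hw
    · apply hδt
      rw [Metric.mem_ball, dist_comm, Real.dist_eq]
      refine ((hν.mono (le_max_right _ _) (min_le_right _ _)) w hk).trans_lt ?_
      rw [div_mul_eq_mul_div, div_lt_iff₀ (by positivity)]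
      nlinarith
    · exact h ν (hν.mono (le_max_left _ _) (min_le_left _ _)) w hw

theorem isOpen_norm_lt (n : ℕ) :
    IsOpen {μ : PseudoNorm | ∃ c : ℝ, 0 < c ∧ ∀ v, SuppLT n v → c * l1 v ≤ μ v} := by
  refine isOpen_iff_mem_nhds.2 fun μ ⟨c, hc, h⟩ => ?_
  filter_upwards [close_mem_nhds n (half_pos hc) μ] with ν hν
  refine ⟨c / 2, half_pos hc, fun v hv => ?_⟩
  have := (abs_le.1 (hν v hv)).2
  linarith [h v hv]

theorem linearIndependent_E_iff (μ : PseudoNorm) :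
    LinearIndependent ℝ (E μ) ↔ ∀ x : ℕ →₀ ℝ, extend μ x = 0 → x = 0 := by
  rw [linearIndependent_iff]
  refine forall_congr' fun x => ?_
  rw [← norm_eq_zero, norm_lc_E]

/-- An injective linear map on a finite-dimensional space is bounded below; conversely a lower bound
on rational combinations passes to real ones by density. -/
theorem linearIndependent_E_iff_lower (μ : PseudoNorm) :
    LinearIndependent ℝ (E μ) ↔
      ∀ n, ∃ c : ℝ, 0 < c ∧ ∀ v, SuppLT n v → c * l1 v ≤ μ v := by
  constructor
  · intro h n
    let L : (Fin n → ℝ) →ₗ[ℝ] X μ := Fintype.linearCombination ℝ fun i => E μ i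
    have hL : L.ker = ⊥ := by
      refine LinearMap.ker_eq_bot'.2 fun x hx => funext ?_
      exact Fintype.linearIndependent_iff.1
        (h.comp (fun i : Fin n => (i : ℕ)) Fin.val_injective) x hx
    obtain ⟨K, hK, hA⟩ := L.exists_antilipschitzWith hL
    have hK' : (0 : ℝ) < K := hK
    refine ⟨1 / ((n + 1) * K), by positivity, fun v hv => ?_⟩
    have h1 := hA.le_mul_norm (x := fun i : Fin n => (v i : ℝ)) (map_zero L)
    have h2 : ‖L fun i : Fin n => (v i : ℝ)‖ = μ v := by
      conv_rhs => rw [← normSeq_E μ, normSeq_apply, hv.lc_eq]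
      rw [Finset.sum_range]
      rfl
    rw [h2] at h1
    have h3 : l1 v ≤ n * ‖fun i : Fin n => (v i : ℝ)‖ := by
      rw [hv.l1_eq, Finset.sum_range]
      refine (Finset.sum_le_card_nsmul _ _ _ fun i _ =>
        norm_le_pi_norm (fun i : Fin n => (v i : ℝ)) i).trans (by simp)
    rw [div_mul_eq_mul_div, div_le_iff₀ (by positivity), one_mul]
    nlinarith [norm_nonneg fun i : Fin n => (v i : ℝ)]
  · intro h
    rw [linearIndependent_iff']
    intro s x hx
    obtain ⟨n, hn⟩ := s.exists_nat_subset_range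
    obtain ⟨c, hc, hl⟩ := h n
    classical
    have h1 := le_norm_real (z := E μ) (n := n) (c := c) (by rwa [normSeq_E])
      (fun i => if i ∈ s then x i else 0)
    have h2 : ∑ i ∈ Finset.range n, (if i ∈ s then x i else 0) • E μ i = 0 := by
      rw [← hx, ← Finset.sum_subset hn]
      · exact Finset.sum_congr rfl fun i hi => by simp [hi]
      · intro i _ hi
        simp [hi]
    rw [h2, norm_zero] at h1
    have h3 : ∑ i ∈ Finset.range n, |if i ∈ s then x i else 0| ≤ 0 := by
      by_contra h'
      push Not at h'
      nlinarith
    intro i hi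
    have := (Finset.sum_eq_zero_iff_of_nonneg (fun _ _ => abs_nonneg _)).1
      (h3.antisymm (Finset.sum_nonneg fun _ _ => abs_nonneg _)) i (hn hi)
    simpa [hi] using this

theorem mem_B_iff (μ : PseudoNorm) : μ ∈ B ↔ LinearIndependent ℝ (E μ) := by
  rw [linearIndependent_E_iff]
  refine ⟨fun h => h.2, fun h => ⟨fun hf => ?_, h⟩⟩
  have := (linearIndependent_E_iff μ).2 h
  exact not_finite_iff_infinite.2 (inferInstanceAs (Infinite ℕ)) this.finite

theorem B_eq : B = ⋂ n : ℕ, {μ | ∃ c : ℝ, 0 < c ∧ ∀ v, SuppLT n v → c * l1 v ≤ μ v} := by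
  ext μ
  rw [mem_B_iff, linearIndependent_E_iff_lower, mem_iInter]
  rfl

/-- A countable intersection of open subsets of a Polish space is Polish. -/
theorem polishSpace_iInter {S : Type*} [TopologicalSpace S] [PolishSpace S] {U : ℕ → Set S}
    (hU : ∀ n, IsOpen (U n)) : PolishSpace (⋂ n, U n : Set S) := by
  have : ∀ n, PolishSpace (U n) := fun n => (hU n).polishSpace
  -- The diagonal embedding into a product of Polish spaces; its range is closed, being the set
  -- where all coordinates agree.
  let f : (⋂ n, U n : Set S) → ∀ n, U n := fun x n => ⟨x, mem_iInter.1 x.2 n⟩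
  have hf : Continuous f := by fun_prop
  have hr : range f = ⋂ n, {g | (g n : S) = g 0} := by
    ext g
    constructor
    · rintro ⟨x, rfl⟩
      exact mem_iInter.2 fun n => rfl
    · intro hg
      replace hg := mem_iInter.1 hg
      exact ⟨⟨g 0, mem_iInter.2 fun n => hg n ▸ (g n).2⟩, funext fun n => Subtype.ext (hg n).symm⟩
  have hi : IsEmbedding f :=
    IsEmbedding.of_comp hf (g := fun g => (g 0 : S)) (by fun_prop) IsEmbedding.subtypeVal
  refine IsClosedEmbedding.polishSpace (f := f) ⟨hi, ?_⟩
  · rw [hr]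
    exact isClosed_iInter fun n => isClosed_eq (by fun_prop) (by fun_prop)

instance : PolishSpace B := by
  rw [B_eq]
  exact polishSpace_iInter isOpen_norm_lt

theorem mem_B_of_le {μ : PseudoNorm} {c : ℝ} (hc : 0 < c) (h : ∀ v, c * l1 v ≤ μ v) : μ ∈ B := by
  rw [B_eq, mem_iInter]
  exact fun n => ⟨c, hc, fun v _ => h v⟩

theorem dense_in_B {A : Set B} (h : ∀ μ ∈ B, ∀ n, ∀ ε > 0, ∃ ν : B, ν ∈ A ∧ Close n ε μ ν) :
    Dense A := by
  intro μ
  rw [mem_closure_iff_nhds]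
  intro U hU
  obtain ⟨W, hW, hWU⟩ := mem_nhds_subtype _ _ _ |>.1 hU
  obtain ⟨n, ε, hε, H⟩ := exists_close_subset hW
  obtain ⟨ν, hA, hν⟩ := h μ μ.2 n ε hε
  exact ⟨ν, hWU (H ν hν), hA⟩

end Topology

/-! ### Amalgamation of pseudonorms -/

section Amalgam

/-- Two pseudonorms that differ by at most `N` along a common domain can be amalgamated so that
the two copies of the domain are within `N` of each other. -/
theorem exists_amalgam {U W T : Type*} [AddCommGroup U] [AddCommGroup W] [AddCommGroup T]
    [Module ℚ U] [Module ℚ W] [Module ℚ T] (μ : Seminorm ℚ U) (p : Seminorm ℚ W)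
    (N : Seminorm ℚ T) (S : T →ₗ[ℚ] U) (R : T →ₗ[ℚ] W) (h : ∀ z, |μ (S z) - p (R z)| ≤ N z) :
    ∃ ν : Seminorm ℚ (U × W), (∀ u, ν (u, 0) = μ u) ∧ (∀ w, ν (0, w) = p w) ∧
      ∀ z, ν (S z, -R z) ≤ N z := by
  -- The amalgam is the infimum of `F x` over `z`: mass may be moved from `S z` to `R z` at cost `N
  -- z`. The hypothesis says that such a move never makes a vector of either factor cheaper.
  let F : U × W → T → ℝ := fun x z => μ (x.1 - S z) + p (x.2 + R z) + N z
  have hF : ∀ x z, 0 ≤ F x z := fun x z =>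
    add_nonneg (add_nonneg (apply_nonneg _ _) (apply_nonneg _ _)) (apply_nonneg _ _)
  have hb : ∀ x, BddBelow (range (F x)) := fun x => ⟨0, by rintro _ ⟨z, rfl⟩; exact hF x z⟩
  have hle : ∀ x z, ⨅ z, F x z ≤ F x z := fun x z => ciInf_le (hb x) z
  have h1 : ∀ u, ⨅ z, F (u, 0) z = μ u := fun u => by
    refine le_antisymm ((hle _ 0).trans (by simp [F])) (le_ciInf fun z => ?_)
    have a := (abs_le.1 (h z)).2
    have b := map_add_le_add μ (u - S z) (S z)
    simp only [sub_add_cancel] at b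
    simp only [F, zero_add]
    linarith
  have h2 : ∀ w, ⨅ z, F (0, w) z = p w := fun w => by
    refine le_antisymm ((hle _ 0).trans (by simp [F])) (le_ciInf fun z => ?_)
    have a := (abs_le.1 (h z)).1
    have b := map_sub_le_add p (w + R z) (R z)
    simp only [add_sub_cancel_right] at b
    simp only [F, zero_sub, map_neg_eq_map]
    linarith
  refine ⟨Seminorm.ofSMulLE (fun x => ⨅ z, F x z) ?_ ?_ ?_, h1, h2, fun z => ?_⟩
  · have := h1 0
    rwa [map_zero] at this
  · intro x y
    refine le_ciInf_add_ciInf fun z w => (hle _ (z + w)).trans ?_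
    have a := map_add_le_add μ (x.1 - S z) (y.1 - S w)
    have b := map_add_le_add p (x.2 + R z) (y.2 + R w)
    have c := map_add_le_add N z w
    rw [show x.1 - S z + (y.1 - S w) = (x + y).1 - S (z + w) by simp; abel] at a
    rw [show x.2 + R z + (y.2 + R w) = (x + y).2 + R (z + w) by simp; abel] at b
    simp only [F]
    linarith
  · intro q x
    rw [Real.mul_iInf_of_nonneg (norm_nonneg _)]
    refine le_ciInf fun z => (hle _ (q • z)).trans (le_of_eq ?_)
    have a : (q • x).1 - S (q • z) = q • (x.1 - S z) := by simp [smul_sub]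
    have b : (q • x).2 + R (q • z) = q • (x.2 + R z) := by simp [smul_add]
    simp only [F]
    rw [a, b, map_smul_eq_mul, map_smul_eq_mul, map_smul_eq_mul]
    ring
  · exact (hle _ z).trans (by simp [F])

/-- The projection onto the first `n` coordinates. -/
noncomputable def proj (n : ℕ) : V →ₗ[ℚ] V :=
  Finsupp.linearCombination ℚ fun i => if i < n then Finsupp.single i 1 else 0

/-- The shift of coordinates by `N` to the right. -/
noncomputable def shiftR (N : ℕ) : V →ₗ[ℚ] V :=
  Finsupp.linearCombination ℚ fun i => Finsupp.single (N + i) 1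

/-- The shift of coordinates by `N` to the left. -/
noncomputable def shiftL (N : ℕ) : V →ₗ[ℚ] V :=
  Finsupp.linearCombination ℚ fun i => if N ≤ i then Finsupp.single (i - N) 1 else 0

theorem proj_single (n i : ℕ) :
    proj n (Finsupp.single i 1) = if i < n then Finsupp.single i 1 else 0 := by
  simp [proj]

theorem shiftR_single (N i : ℕ) : shiftR N (Finsupp.single i 1) = Finsupp.single (N + i) 1 := by
  simp [shiftR]

theorem shiftL_single (N i : ℕ) :
    shiftL N (Finsupp.single i 1) = if N ≤ i then Finsupp.single (i - N) 1 else 0 := by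
  simp [shiftL]

theorem proj_apply (n : ℕ) (v : V) (i : ℕ) : proj n v i = if i < n then v i else 0 := by
  induction v using Finsupp.induction_linear with
  | zero => simp
  | add v w hv hw => rw [map_add, Finsupp.add_apply, hv, hw]; split_ifs <;> simp
  | single j q =>
    have : (Finsupp.single j q : V) = q • Finsupp.single j 1 := by simp
    rw [this, map_smul, proj_single]
    by_cases hij : j = i
    · subst hij
      by_cases hj : j < n <;> simp [hj]
    · by_cases hj : j < n <;> simp [hj, hij]

theorem suppLT_proj (n : ℕ) (v : V) : SuppLT n (proj n v) := fun i hi => by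
  simp [proj_apply, not_lt.2 hi]

theorem SuppLT.proj_eq {n : ℕ} {v : V} (hv : SuppLT n v) : proj n v = v := by
  ext i
  rw [proj_apply]
  split_ifs with h
  · rfl
  · exact (hv i (not_lt.1 h)).symm

theorem shiftL_shiftR (N : ℕ) (v : V) : shiftL N (shiftR N v) = v := by
  have : shiftL N ∘ₗ shiftR N = LinearMap.id := by
    refine Finsupp.lhom_ext' fun i => LinearMap.ext_ring ?_
    simp [shiftR_single, shiftL_single]
  exact LinearMap.congr_fun this v

theorem proj_shiftR (N : ℕ) (v : V) : proj N (shiftR N v) = 0 := by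
  have : proj N ∘ₗ shiftR N = 0 := by
    refine Finsupp.lhom_ext' fun i => LinearMap.ext_ring ?_
    simp [shiftR_single, proj_single]
  exact LinearMap.congr_fun this v

theorem SuppLT.shiftL_eq {N : ℕ} {v : V} (hv : SuppLT N v) : shiftL N v = 0 := by
  have h : shiftL N ∘ₗ proj N = 0 := by
    refine Finsupp.lhom_ext' fun i => LinearMap.ext_ring ?_
    by_cases h : i < N <;> simp [proj_single, h, shiftL_single]
  rw [← hv.proj_eq]
  exact LinearMap.congr_fun h v

/-- If `p` is close to `μ` along `g`, then the first `N` coordinates with `μ` and the remaining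
ones with `p` amalgamate, the `i`-th new coordinate being close to `g i`. -/
theorem exists_extension {n : ℕ} {δ : ℝ} (hδ : 0 ≤ δ) {μ p : PseudoNorm} {g : ℕ → V}
    (h : Close n δ p (pull μ g)) (N : ℕ) :
    ∃ ν : PseudoNorm, (∀ u, SuppLT N u → ν u = μ u) ∧ (∀ y, ν (shiftR N y) = p y) ∧
      ∀ i < n, SuppLT N (g i) → ν (g i - Finsupp.single (N + i) 1) ≤ δ := by
  let δ' : NNReal := ⟨δ, hδ⟩
  let S : V →ₗ[ℚ] V := Finsupp.linearCombination ℚ g ∘ₗ proj n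
  obtain ⟨ν, h1, h2, h3⟩ := exists_amalgam μ p (δ' • l1.comp (proj n)) S (proj n)
    (fun z => by rw [abs_sub_comm]; exact h _ (suppLT_proj n z))
  -- Splitting `V` into the first `N` coordinates and the shifted remainder places the two factors
  -- of the amalgam side by side.
  refine ⟨ν.comp ((proj N).prod (shiftL N)), fun u hu => ?_, fun y => ?_, fun i hi hg => ?_⟩
  · rw [← h1]
    simp [hu.proj_eq, hu.shiftL_eq]
  · rw [← h2]
    simp [shiftL_shiftR, proj_shiftR]
  · have := h3 (Finsupp.single i 1)
    have e : (δ' • l1.comp (proj n)) (Finsupp.single i 1) = δ := by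
      change δ * l1 (proj n (Finsupp.single i 1)) = δ
      rw [proj_single, if_pos hi, l1_single]
      simp
    rw [e] at this
    refine le_trans (le_of_eq ?_) this
    simp [S, proj_single, hi, hg.proj_eq, hg.shiftL_eq, shiftL_single]

theorem pull_single (μ : PseudoNorm) (n : ℕ) : pull μ (fun i => Finsupp.single (n + i) 1) =
    μ.comp (shiftR n) := rfl

theorem linearCombination_single (v : V) :
    Finsupp.linearCombination ℚ (fun i => (Finsupp.single i 1 : V)) v = v := by
  rw [Finsupp.linearCombination_apply]
  simp

end Amalgam

/-! ### Approximate realization in a Gurariĭ space -/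

section Gurarii

variable {G : Type*} [NormedAddCommGroup G] [NormedSpace ℝ G]

theorem IsKIsomorphism.abs_sub_le {F : Type*} [NormedAddCommGroup F] [NormedSpace ℝ F] {ε : ℝ}
    (hε : 0 < ε) {f : F →L[ℝ] G} (hf : IsKIsomorphism (1 + ε) f) (x : F) :
    |‖x‖ - ‖f x‖| ≤ ε * ‖x‖ := by
  obtain ⟨h1, h2⟩ := hf x
  rw [inv_mul_le_iff₀ (by positivity)] at h1
  rw [abs_le]
  refine ⟨by linarith, ?_⟩
  by_cases h : ‖f x‖ ≤ ‖x‖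
  · nlinarith
  · nlinarith [mul_nonneg hε.le (norm_nonneg x)]

/-- In a Gurariĭ space, a pseudonorm close to the one given by a finite sequence is realized up to
`ε` by a sequence close to the given one. -/
theorem IsGurarii.exists_close (hG : IsGurarii G) {n m : ℕ} (hnm : n ≤ m) {δ ε : ℝ} (hδ : 0 ≤ δ)
    (hε : 0 < ε) {p : PseudoNorm} {g : ℕ → G} (hc : Close n δ p (normSeq g)) :
    ∃ h : ℕ → G, (∀ i < n, ‖h i - g i‖ ≤ δ + ε) ∧ Close m ε p (normSeq h) := by
  obtain ⟨ν, h1, h2, h3⟩ := exists_extension (μ := normSeq g) (p := p)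
    (g := fun i => Finsupp.single i 1) hδ (n := n) (fun v hv => by
      rw [pull_apply, linearCombination_single]; exact hc v hv) n
  -- In `X ν` the first `n` unit vectors copy `g`, and the next `m` realize `p`. Since `J` and `L`
  -- give the same norms, `J` composed with any linear section of `L` is an isometric embedding of
  -- the span of `g`, even when `g` is linearly dependent.
  let J : (Fin n → ℝ) →ₗ[ℝ] X ν := Fintype.linearCombination ℝ fun i => E ν i
  let L : (Fin n → ℝ) →ₗ[ℝ] G := Fintype.linearCombination ℝ fun i => g i
  have hJL : ∀ x, ‖J x‖ = ‖L x‖ := fun x => by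
    have hc0 : Close n 0 (normSeq (E ν)) (normSeq g) := fun v hv => by
      rw [normSeq_E, h1 v hv]; simp
    have := hc0.real fun i => if hi : i < n then x ⟨i, hi⟩ else 0
    rw [zero_mul, Finset.sum_range, Finset.sum_range] at this
    simp only [Fin.is_lt, dite_true, Fin.eta] at this
    exact sub_eq_zero.1 (abs_nonpos_iff.1 this)
  let F : Submodule ℝ (X ν) := Submodule.span ℝ (range fun i : Fin (n + m) => E ν i)
  have hEF : ∀ i < n + m, E ν i ∈ F := fun i hi => Submodule.subset_span ⟨⟨i, hi⟩, rfl⟩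
  have hJF : ∀ x, J x ∈ F := fun x => by
    simp only [J, Fintype.linearCombination_apply]
    exact Submodule.sum_mem _ fun i _ => F.smul_mem _ (hEF i (by omega))
  have : FiniteDimensional ℝ F := FiniteDimensional.span_of_finite ℝ (finite_range _)
  obtain ⟨s, hs⟩ := L.rangeRestrict.exists_rightInverse_of_surjective
    (LinearMap.range_eq_top.2 L.surjective_rangeRestrict)
  have hs' : ∀ a, L (s a) = a := fun a => congrArg Subtype.val (LinearMap.congr_fun hs a)
  let e : L.range →ₗᵢ[ℝ] F :=
    { toLinearMap := (J ∘ₗ s).codRestrict F fun a => hJF _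
      norm_map' := fun a => by
        change ‖J (s a)‖ = ‖(a : G)‖
        rw [hJL, hs'] }
  have hgL : ∀ i : Fin n, L (Pi.single i 1) = g i := fun i => by
    simp [L, Fintype.linearCombination_apply_single]
  have hgJ : ∀ i : Fin n, J (Pi.single i 1) = E ν i := fun i => by
    simp [J, Fintype.linearCombination_apply_single]
  have he : ∀ i : Fin n, e ⟨g i, ⟨_, hgL i⟩⟩ = ⟨E ν i, hEF i (by omega)⟩ := fun i => by
    apply Subtype.ext
    change J (s _) = E ν i
    rw [← hgJ i, ← sub_eq_zero, ← norm_eq_zero, ← map_sub, hJL, map_sub, hs', hgL]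
    simp
  -- `K` collects every quantity that gets multiplied by the distortion `η`, so that `η * K = ε`
  -- pays for all errors at once.
  set K : ℝ := 1 + δ + ∑ i ∈ Finset.range n, ‖g i‖ +
    ∑ i ∈ Finset.range m, p (Finsupp.single i 1) with hK
  have k1 : 0 ≤ ∑ i ∈ Finset.range n, ‖g i‖ := Finset.sum_nonneg fun _ _ => norm_nonneg _
  have k2 : 0 ≤ ∑ i ∈ Finset.range m, p (Finsupp.single i 1) :=
    Finset.sum_nonneg fun _ _ => apply_nonneg _ _
  have hK0 : 0 < K := by linarith
  set η : ℝ := ε / K with hη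
  have hη0 : 0 < η := by positivity
  have hηK : η * K = ε := by rw [hη]; field_simp
  obtain ⟨f, hf, hfe⟩ := hG.extension η hη0 L.range F e
  refine ⟨fun i => if hi : i < m then f ⟨E ν (n + i), hEF _ (by omega)⟩ else 0,
    fun i hi => ?_, fun v hv => ?_⟩
  · beta_reduce
    rw [dif_pos (by omega)]
    have a1 : ‖f (e ⟨g i, ⟨_, hgL ⟨i, hi⟩⟩⟩) - g i‖ ≤ η * ‖g i‖ :=
      (f.comp e.toContinuousLinearMap - L.range.subtypeL).le_of_opNorm_le hfe
        ⟨g i, ⟨_, hgL ⟨i, hi⟩⟩⟩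
    rw [he ⟨i, hi⟩] at a1
    have a2 : ‖E ν (n + i) - E ν i‖ ≤ δ := by
      rw [← coeX_single, ← coeX_single, ← coeX_sub, norm_coeX, map_sub_rev]
      exact h3 i hi (suppLT_single hi 1)
    have a3 : ‖f ⟨E ν (n + i), hEF _ (by omega)⟩ - f ⟨E ν i, hEF _ (by omega)⟩‖ ≤
        (1 + η) * δ := by
      rw [← map_sub]
      exact (hf _).2.trans (mul_le_mul_of_nonneg_left a2 (by positivity))
    have a4 : ‖g i‖ ≤ ∑ i ∈ Finset.range n, ‖g i‖ :=
      Finset.single_le_sum (f := fun i => ‖g i‖) (fun _ _ => norm_nonneg _)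
        (Finset.mem_range.2 hi)
    have a5 := norm_sub_le_norm_sub_add_norm_sub (f ⟨E ν (n + i), hEF _ (by omega)⟩)
      (f ⟨E ν i, hEF _ (by omega)⟩) (g i)
    nlinarith
  · rw [normSeq_apply, hv.lc_eq]
    let x : F := ∑ i : Fin m, (v i : ℝ) • (⟨E ν (n + i), hEF _ (by omega)⟩ : F)
    have b1 : ‖x‖ = p v := by
      rw [← h2, ← norm_coeX, coeX, shiftR, toReal_linearCombination _ v hv, Finset.sum_range]
      simp [x, toReal_single]
    have b2 : f x = ∑ i ∈ Finset.range m, (v i : ℝ) •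
        (if hi : i < m then f ⟨E ν (n + i), hEF _ (by omega)⟩ else 0) := by
      rw [Finset.sum_range, map_sum]
      exact Finset.sum_congr rfl fun i _ => by rw [map_smul, dif_pos i.2]
    rw [← b1, ← b2]
    refine (hf.abs_sub_le hη0 x).trans ?_
    rw [b1]
    have b3 : p v ≤ (∑ i ∈ Finset.range m, p (Finsupp.single i 1)) * l1 v :=
      apply_le_mul_l1 p (fun i hi => Finset.single_le_sum (f := fun i => p (Finsupp.single i 1))
        (fun _ _ => apply_nonneg _ _) (Finset.mem_range.2 hi)) hv
    have b4 : 0 ≤ l1 v := apply_nonneg _ _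
    calc η * p v ≤ η * (K * l1 v) := by
          refine mul_le_mul_of_nonneg_left (b3.trans ?_) hη0.le
          exact mul_le_mul_of_nonneg_right (by linarith) b4
      _ = ε * l1 v := by rw [← mul_assoc, hηK]

end Gurarii

/-! ### The Gurariĭ property as a dense `G_δ` condition -/

section GurariiSet

open Filter Topology

instance : Nonempty PseudoNorm := ⟨l1⟩

theorem continuous_pull (h : ℕ → V) : Continuous fun μ : PseudoNorm => pull μ h :=
  continuous_induced_rng.2 (continuous_pi fun _ => continuous_eval _)

theorem isClosed_close (n : ℕ) (ε : ℝ) (p : PseudoNorm) : IsClosed {q | Close n ε p q} := by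
  have : {q | Close n ε p q} = ⋂ (v : V) (_ : SuppLT n v), {q | |p v - q v| ≤ ε * l1 v} := by
    ext q
    simp only [mem_iInter]
    rfl
  rw [this]
  exact isClosed_iInter fun v => isClosed_iInter fun _ =>
    isClosed_le (continuous_const.sub (continuous_eval v)).abs continuous_const

/-- One instance of the extension property of the Gurariĭ space, for the pseudonorm of index `j`
in a fixed dense sequence, precision `1 / (k + 1)` and a finite sequence `g` of vectors of `V`. -/
def extensionSet (n m k j : ℕ) (g : ℕ →₀ V) : Set PseudoNorm :=
  {μ | Close n (1 / (k + 1)) (denseSeq PseudoNorm j) (pull μ g) →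
    ∃ h : ℕ → V, (∀ i ∈ Finset.range n, μ (h i - g i) < 2 * (1 / (k + 1))) ∧
      pull μ h ∈ interior {q | Close (n + m) (1 / (k + 1)) (denseSeq PseudoNorm j) q}}

/-- The premise is closed, and the conclusion is a union of open sets thanks to the strict
inequality and the interior; hence the implication is open. -/
theorem isOpen_extensionSet (n m k j : ℕ) (g : ℕ →₀ V) : IsOpen (extensionSet n m k j g) := by
  have : extensionSet n m k j g =
      ((fun μ => pull μ g) ⁻¹' {q | Close n (1 / (k + 1)) (denseSeq PseudoNorm j) q})ᶜ ∪
      ⋃ h : ℕ → V, ((⋂ i ∈ Finset.range n, {μ | μ (h i - g i) < 2 * (1 / ((k : ℝ) + 1))}) ∩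
        (fun μ => pull μ h) ⁻¹'
          interior {q | Close (n + m) (1 / (k + 1)) (denseSeq PseudoNorm j) q}) := by
    ext μ
    simp only [mem_union, mem_compl_iff, mem_iUnion, mem_inter_iff, mem_iInter]
    exact imp_iff_not_or
  rw [this]
  refine ((isClosed_close _ _ _).preimage (continuous_pull _)).isOpen_compl.union
    (isOpen_iUnion fun h => IsOpen.inter ?_ (isOpen_interior.preimage (continuous_pull h)))
  exact isOpen_biInter_finset fun i _ => isOpen_lt (continuous_eval _) continuous_const

/-- The set of pseudonorms `μ` for which `X μ` is a Gurariĭ space, see `mem_gurariiSet_iff`. -/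
def gurariiSet : Set PseudoNorm :=
  ⋂ t : ℕ × ℕ × ℕ × ℕ × (ℕ →₀ V), extensionSet t.1 t.2.1 t.2.2.1 t.2.2.2.1 t.2.2.2.2

theorem isGδ_gurariiSet : IsGδ gurariiSet :=
  .iInter_of_isOpen fun _ => isOpen_extensionSet _ _ _ _ _

/-- Realization with tolerance `δ / 4`, followed by rounding to `V` at cost `δ / 4`, keeps the
displacement below `2 * δ` and leaves `δ / 2` of room for the interior. -/
theorem mem_gurariiSet_of_isGurarii {μ : PseudoNorm} (hμ : IsGurarii (X μ)) :
    μ ∈ gurariiSet := by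
  refine mem_iInter.2 fun ⟨n, m, k, j, g⟩ hc => ?_
  simp only at hc ⊢
  set δ : ℝ := 1 / (k + 1) with hδ
  have hδ0 : 0 < δ := by positivity
  rw [pull_eq] at hc
  obtain ⟨h', h1, h2⟩ := hμ.exists_close (Nat.le_add_right n m) hδ0.le
    (ε := δ / 4) (by positivity) hc
  choose h hh using fun i => exists_coeX_near (h' i) (ε := δ / 4) (by positivity)
  refine ⟨h, fun i hi => ?_, ?_⟩
  · rw [← norm_coeX, coeX_sub]
    have a1 := norm_sub_le_norm_sub_add_norm_sub (coeX μ (h i)) (h' i) (coeX μ (g i))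
    linarith [hh i, h1 i (Finset.mem_range.1 hi)]
  · rw [mem_interior_iff_mem_nhds]
    filter_upwards [close_mem_nhds (n + m) (half_pos hδ0) (pull μ h)] with q hq
    have a1 : Close (n + m) (δ / 4) (normSeq h') (pull μ h) := by
      rw [pull_eq]
      exact close_normSeq fun i _ => by rw [norm_sub_rev]; exact (hh i).le
    exact ((h2.trans a1).trans hq).mono le_rfl (by linarith)

theorem exists_sum_repr_le {F : Type*} [NormedAddCommGroup F] [NormedSpace ℝ F]
    [FiniteDimensional ℝ F] {n : ℕ} (b : Module.Basis (Fin n) ℝ F) :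
    ∃ C : ℝ, 0 ≤ C ∧ ∀ x, ∑ i, |b.repr x i| ≤ C * ‖x‖ := by
  let L : F →L[ℝ] (Fin n → ℝ) := LinearMap.toContinuousLinearMap b.equivFun.toLinearMap
  refine ⟨n * ‖L‖, by positivity, fun x => ?_⟩
  have h : ∀ i, |b.repr x i| ≤ ‖L‖ * ‖x‖ := fun i =>
    (norm_le_pi_norm (L x) i).trans (L.le_opNorm x)
  refine (Finset.sum_le_card_nsmul _ _ _ fun i _ => h i).trans ?_
  simp [mul_assoc]

theorem exists_basis_extending {F : Type*} [AddCommGroup F] [Module ℝ F]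
    [FiniteDimensional ℝ F] {n : ℕ} {v : Fin n → F} (hv : LinearIndependent ℝ v) :
    ∃ (k : ℕ) (b : Module.Basis (Fin (n + k)) ℝ F), ∀ i, b (Fin.castAdd k i) = v i := by
  classical
  let b := Module.Basis.sumExtend hv
  have : Finite (Fin n ⊕ Module.Basis.sumExtendIndex hv) := Module.Finite.finite_basis b
  have : Finite (Module.Basis.sumExtendIndex hv) := 
    Finite.of_injective (Sum.inr : _ → Fin n ⊕ Module.Basis.sumExtendIndex hv) Sum.inr_injective
  obtain ⟨k, ⟨e⟩⟩ := Finite.exists_equiv_fin (Module.Basis.sumExtendIndex hv)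
  refine ⟨k, b.reindex ((Equiv.sumCongr (Equiv.refl _) e).trans finSumFinEquiv), fun i => ?_⟩
  simp only [b, Module.Basis.sumExtend, Module.Basis.reindex_apply, Module.Basis.extend_apply_self]
  simp only [Equiv.symm_trans_apply, finSumFinEquiv_symm_apply_castAdd,
    Equiv.sumCongr_symm, Equiv.sumCongr_apply, Sum.map_inl, Equiv.refl_symm, Equiv.refl_apply]
  exact congrArg Subtype.val (Equiv.Set.sumDiffSubset_apply_inl
    (hv.linearIndepOn_id.subset_extend (subset_univ _)) (Equiv.ofInjective v hv.injective i))

/-- A basis of `A` is carried to `F` and extended to a basis there. The norm of `F` is approximated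
by a member of the dense sequence, and the vectors `h i` from the extension condition become the
images of the basis. As all norms on `F` are equivalent, an `ℓ₁`-error is a relative error. -/
theorem isGurarii_of_mem_gurariiSet {μ : PseudoNorm} (hμ : μ ∈ gurariiSet) :
    IsGurarii (X μ) := by
  refine ⟨inferInstance, inferInstance, fun ε hε A F _ _ _ g => ?_⟩
  have : FiniteDimensional ℝ A := FiniteDimensional.of_injective g.toLinearMap g.injective
  let n := Module.finrank ℝ A
  let bA : Module.Basis (Fin n) ℝ A := Module.finBasis ℝ A
  have hli : LinearIndependent ℝ (fun i => g (bA i)) :=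
    bA.linearIndependent.map' g.toLinearMap (LinearMap.ker_eq_bot.2 g.injective)
  obtain ⟨k, b, hb⟩ := exists_basis_extending hli
  obtain ⟨C, hC, hCb⟩ := exists_sum_repr_le b
  obtain ⟨C', hC', hCb'⟩ := exists_sum_repr_le bA
  let z : ℕ → F := fun i => if h : i < n + k then b ⟨i, h⟩ else 0
  let a : ℕ → A := fun i => if h : i < n then bA ⟨i, h⟩ else 0
  have hza : ∀ i < n, z i = g (a i) := fun i hi => by
    simp only [z, a, hi, dite_true, show i < n + k by omega]
    exact hb ⟨i, hi⟩
  -- Chosen so that `1 - s` is exactly the lower constant `(1 + ε)⁻¹`, while `1 + s ≤ 1 + ε`.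
  set s : ℝ := ε / (1 + ε) with hs
  have hs0 : 0 < s := by positivity
  have hs1 : (1 + ε)⁻¹ = 1 - s := by rw [hs]; field_simp; ring
  have hsε : s ≤ ε := by rw [hs]; exact div_le_self hε.le (by linarith)
  obtain ⟨K, hK⟩ := exists_nat_one_div_lt (show 0 < s / (3 * (C + C' + 1)) by positivity)
  set δ : ℝ := 1 / (K + 1) with hδ
  have hδ0 : 0 < δ := by positivity
  rw [lt_div_iff₀ (by positivity)] at hK
  have hδC : 2 * δ * C ≤ s := by nlinarith
  have hδC' : 3 * δ * C' ≤ s := by nlinarith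
  choose g₀ hg₀ using fun i => exists_coeX_near (a i : X μ) (ε := δ / 2) (by positivity)
  let g' : ℕ →₀ V := Finsupp.onFinset (Finset.range n) (fun i => if i < n then g₀ i else 0)
    (by simp +contextual)
  have hg' : ∀ i < n, ‖coeX μ (g' i) - a i‖ ≤ δ / 2 := fun i hi => by
    simp only [g', Finsupp.onFinset_apply, hi, if_true]
    exact (hg₀ i).le
  obtain ⟨j, hj⟩ : ∃ j, Close (n + k) (δ / 2) (normSeq z) (denseSeq PseudoNorm j) := by
    obtain ⟨_, ⟨j, rfl⟩, h1⟩ := (denseRange_denseSeq PseudoNorm).inter_nhds_nonempty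
      (close_mem_nhds (n + k) (half_pos hδ0) (normSeq z))
    exact ⟨j, h1⟩
  have hclose : Close n δ (denseSeq PseudoNorm j) (pull μ g') := by
    have c1 : Close n 0 (normSeq z) (normSeq fun i => (a i : X μ)) := by
      have : normSeq (fun i => (a i : X μ)) = normSeq fun i => g (a i) :=
        (normSeq_comp A.subtypeₗᵢ a).trans (normSeq_comp g a).symm
      rw [this]
      exact close_normSeq fun i hi => by rw [hza i hi, sub_self, norm_zero]
    have c2 : Close n (δ / 2) (normSeq fun i => (a i : X μ)) (pull μ g') := by
      rw [pull_eq]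
      exact close_normSeq fun i hi => by rw [norm_sub_rev]; exact hg' i hi
    exact (((hj.symm.mono (Nat.le_add_right n k) le_rfl).trans c1).trans c2).mono le_rfl
      (by linarith)
  obtain ⟨h, h1, h2⟩ := mem_iInter.1 hμ (n, k, K, j, g') hclose
  simp only at h1 h2
  have hzh : Close (n + k) (2 * δ) (normSeq z) (normSeq fun i => coeX μ (h i)) := by
    rw [← pull_eq]
    exact (hj.trans (interior_subset h2)).mono le_rfl (by linarith)
  let f : F →L[ℝ] X μ := LinearMap.toContinuousLinearMap (b.constr ℝ fun i => coeX μ (h i))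
  have hf : ∀ x, f x = ∑ i, b.repr x i • coeX μ (h i) := fun x => by
    simp [f, Module.Basis.constr_apply_fintype]
  have hfx : ∀ x, |‖x‖ - ‖f x‖| ≤ s * ‖x‖ := fun x => by
    have := hzh.real fun i => if hi : i < n + k then b.repr x ⟨i, hi⟩ else 0
    rw [Finset.sum_range, Finset.sum_range, Finset.sum_range] at this
    simp only [Fin.is_lt, dite_true, Fin.eta, z, b.sum_repr, ← hf] at this
    refine this.trans ?_
    calc 2 * δ * ∑ i, |b.repr x i| ≤ 2 * δ * (C * ‖x‖) := by gcongr; exact hCb x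
      _ ≤ s * ‖x‖ := by rw [← mul_assoc]; gcongr
  refine ⟨f, fun x => ?_, ContinuousLinearMap.opNorm_le_bound _ hε.le fun x => ?_⟩
  · have := abs_le.1 (hfx x)
    rw [hs1]
    constructor
    · linarith
    · nlinarith [norm_nonneg x]
  · have e1 : f (g x) = ∑ i, bA.repr x i • coeX μ (h i) := by
      conv_lhs => rw [← bA.sum_repr x]
      rw [map_sum, map_sum]
      refine Finset.sum_congr rfl fun i _ => ?_
      rw [map_smul, map_smul, ← hb i]
      congr 1
      simp [f]
    have e2 : (x : X μ) = ∑ i, bA.repr x i • (bA i : X μ) := by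
      conv_lhs => rw [← bA.sum_repr x]
      exact map_sum A.subtype _ _
    change ‖f (g x) - (x : X μ)‖ ≤ _
    rw [e1, e2, ← Finset.sum_sub_distrib]
    have e3 : ∀ i : Fin n, ‖coeX μ (h i) - (bA i : X μ)‖ ≤ 3 * δ := fun i => by
      have a1 := h1 i (Finset.mem_range.2 i.2)
      rw [← norm_coeX, coeX_sub] at a1
      have a2 := hg' i i.2
      have a3 : a i = bA i := by simp [a]
      rw [a3] at a2
      have a4 := norm_sub_le_norm_sub_add_norm_sub (coeX μ (h i)) (coeX μ (g' i)) (bA i : X μ)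
      linarith
    calc ‖∑ i, (bA.repr x i • coeX μ (h i) - bA.repr x i • (bA i : X μ))‖
        ≤ ∑ i, |bA.repr x i| * (3 * δ) := norm_sum_le_of_le _ fun i _ => by
          rw [← smul_sub, norm_smul, Real.norm_eq_abs]
          exact mul_le_mul_of_nonneg_left (e3 i) (abs_nonneg _)
      _ = 3 * δ * ∑ i, |bA.repr x i| := by rw [← Finset.sum_mul, mul_comm]
      _ ≤ 3 * δ * (C' * ‖x‖) := by gcongr; exact hCb' x
      _ ≤ ε * ‖x‖ := by rw [← mul_assoc]; gcongr; exact hδC'.trans hsε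

theorem mem_gurariiSet_iff {μ : PseudoNorm} : μ ∈ gurariiSet ↔ IsGurarii (X μ) :=
  ⟨isGurarii_of_mem_gurariiSet, mem_gurariiSet_of_isGurarii⟩

/-- The pseudonorm `μ + η • l1`. -/
noncomputable def addL1 (μ : PseudoNorm) (η : NNReal) : PseudoNorm := μ + η • l1

theorem addL1_apply (μ : PseudoNorm) (η : NNReal) (v : V) : addL1 μ η v = μ v + η * l1 v := rfl

theorem addL1_mem_B (μ : PseudoNorm) {η : NNReal} (hη : 0 < η) : addL1 μ η ∈ B :=
  mem_B_of_le (c := η) hη fun v => by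
    rw [addL1_apply]
    linarith [apply_nonneg μ v]

theorem l1_shiftR_le (N : ℕ) (v : V) : l1 (shiftR N v) ≤ l1 v := by
  obtain ⟨n, hn⟩ := exists_suppLT v
  have := apply_le_mul_l1 (l1.comp (shiftR N)) (M := 1) (n := n) (fun i _ => by
    simp [shiftR_single, l1_single]) hn
  simpa using this

/-- If the premise fails at `μ`, then `μ` itself belongs to the set. Otherwise a copy of the
prescribed pseudonorm is glued on beyond coordinate `N`, which leaves the first `N₀` coordinates and
the supports of the relevant `g i` untouched; adding `η` times `l1` gives a norm. -/
theorem dense_extensionSet (n m k j : ℕ) (g : ℕ →₀ V) :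
    Dense ((↑) ⁻¹' extensionSet n m k j g : Set B) := by
  refine dense_in_B fun μ hμ N₀ ε hε => ?_
  set δ : ℝ := 1 / (k + 1) with hδ
  have hδ0 : 0 < δ := by positivity
  by_cases hc : Close n δ (denseSeq PseudoNorm j) (pull μ g)
  swap
  · exact ⟨⟨μ, hμ⟩, fun h => absurd h hc, (Close.refl N₀ μ).mono le_rfl hε.le⟩
  choose M hM using fun i => exists_suppLT (g i)
  set N := N₀ + ∑ i ∈ Finset.range n, M i with hN
  have hgN : ∀ i < n, SuppLT N (g i) := fun i hi => (hM i).mono <| by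
    have := Finset.single_le_sum (f := M) (fun _ _ => Nat.zero_le _) (Finset.mem_range.2 hi)
    omega
  obtain ⟨ν₀, h1, h2, h3⟩ := exists_extension hδ0.le hc N
  set T : ℝ := ∑ i ∈ Finset.range n, l1 (Finsupp.single (N + i) 1 - g i) with hT
  have hT0 : 0 ≤ T := Finset.sum_nonneg fun _ _ => apply_nonneg _ _
  -- The factor `2 + T` gives both `δ + η * T < 2 * δ` for the displacements and `η ≤ δ / 2` for
  -- closeness on the glued part.
  let η : NNReal := ⟨min ε (δ / (2 + T)), by positivity⟩
  have hη0 : 0 < η := show (0 : ℝ) < min ε (δ / (2 + T)) by positivity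
  have hη0' : (0 : ℝ) < η := hη0
  have hηε : (η : ℝ) ≤ ε := min_le_left _ _
  have hηδ : (η : ℝ) * (2 + T) ≤ δ := by
    rw [← le_div_iff₀ (by positivity)]
    exact min_le_right _ _
  have hη2 : (η : ℝ) ≤ δ / 2 := by nlinarith
  refine ⟨⟨addL1 ν₀ η, addL1_mem_B ν₀ hη0⟩, fun _ => ⟨fun i => Finsupp.single (N + i) 1, ?_, ?_⟩,
    fun v hv => ?_⟩
  · intro i hi
    have a1 := h3 i (Finset.mem_range.1 hi) (hgN i (Finset.mem_range.1 hi))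
    have a2 := Finset.single_le_sum (f := fun i => l1 (Finsupp.single (N + i) 1 - g i))
      (fun _ _ => apply_nonneg _ _) hi
    rw [map_sub_rev] at a1
    rw [addL1_apply]
    nlinarith
  · rw [mem_interior_iff_mem_nhds]
    filter_upwards [close_mem_nhds (n + m) (half_pos hδ0) _] with q hq
    refine (Close.trans (ε := δ / 2) (fun v hv => ?_) hq).mono le_rfl (by linarith)
    rw [pull_single, Seminorm.comp_apply, addL1_apply, h2]
    rw [sub_add_cancel_left, abs_neg, abs_of_nonneg (mul_nonneg hη0'.le (apply_nonneg _ _))]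
    exact mul_le_mul hη2 (l1_shiftR_le N v) (apply_nonneg _ _) (by positivity)
  · rw [addL1_apply, h1 v (hv.mono (by omega)), sub_add_cancel_left, abs_neg,
      abs_of_nonneg (mul_nonneg hη0'.le (apply_nonneg _ _))]
    exact mul_le_mul_of_nonneg_right hηε (apply_nonneg _ _)

theorem dense_gurariiSet : Dense ((↑) ⁻¹' gurariiSet : Set B) := by
  rw [gurariiSet, preimage_iInter]
  exact dense_iInter_of_isOpen
    (fun t => (isOpen_extensionSet _ _ _ _ _).preimage continuous_subtype_val)
    fun t => dense_extensionSet _ _ _ _ _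

theorem l1_mem_B : l1 ∈ B := mem_B_of_le one_pos fun v => by simp

instance : Nonempty B := ⟨⟨l1, l1_mem_B⟩⟩

theorem exists_isGurarii :
    ∃ (G : Type) (_ : NormedAddCommGroup G) (_ : NormedSpace ℝ G), IsGurarii G := by
  obtain ⟨μ, hμ⟩ := dense_gurariiSet.nonempty
  exact ⟨X (μ : PseudoNorm), inferInstance, inferInstance, isGurarii_of_mem_gurariiSet hμ⟩

end GurariiSet

/-! ### Universality and uniqueness by approximate back-and-forth -/

section BackAndForth

theorem exists_rel_seq {α : Type*} {P : ℕ → α → Prop} {R : ℕ → α → α → Prop} {x₀ : α}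
    (h₀ : P 0 x₀) (step : ∀ k x, P k x → ∃ y, P (k + 1) y ∧ R k x y) :
    ∃ s : ℕ → α, ∀ k, P k (s k) ∧ R k (s k) (s (k + 1)) := by
  choose f hf using step
  let s : ∀ k, {x // P k x} := fun k =>
    Nat.rec ⟨x₀, h₀⟩ (fun k x => ⟨f k x.1 x.2, (hf k x.1 x.2).1⟩) k
  exact ⟨fun k => (s k).1, fun k => ⟨(s k).2, (hf k (s k).1 (s k).2).2⟩⟩

theorem eq_of_close {p q : PseudoNorm} (c : ℝ) (h : ∀ k, Close k (c * (1 / 2) ^ k) p q) :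
    p = q := by
  ext v
  obtain ⟨n, hn⟩ := exists_suppLT v
  have h1 : Filter.Tendsto (fun k : ℕ => c * (1 / 2 : ℝ) ^ k * l1 v) Filter.atTop (nhds 0) := by
    have := tendsto_pow_atTop_nhds_zero_of_lt_one (r := (1 / 2 : ℝ)) (by norm_num) (by norm_num)
    simpa using (this.const_mul c).mul_const (l1 v)
  have h2 : |p v - q v| ≤ 0 := ge_of_tendsto h1 <| by
    filter_upwards [Filter.eventually_ge_atTop n] with k hk
    exact h k v (hn.mono hk)
  exact sub_eq_zero.1 (abs_nonpos_iff.1 h2)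

/-- Entry `i` is controlled only from stage `i + 1` on, so each Cauchy sequence starts there; the
geometric tail doubles the constant 2 to 4. -/
theorem exists_limit {G : Type*} [NormedAddCommGroup G] [CompleteSpace G] {a : ℕ → ℕ → G}
    (h : ∀ k, ∀ i < k, ‖a (k + 1) i - a k i‖ ≤ 2 * (1 / 2) ^ k) :
    ∃ A : ℕ → G, ∀ k, ∀ i < k, ‖a k i - A i‖ ≤ 4 * (1 / 2) ^ k := by
  have h1 : ∀ i n, dist (a (n + (i + 1)) i) (a (n + 1 + (i + 1)) i) ≤
      4 * (1 / 2) ^ (i + 1) / 2 / 2 ^ n := fun i n => by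
    rw [dist_comm, dist_eq_norm, show n + 1 + (i + 1) = n + (i + 1) + 1 by ring]
    refine (h _ i (by omega)).trans (le_of_eq ?_)
    rw [pow_add]
    simp only [one_div, inv_pow]
    ring
  choose A hA using fun i => cauchySeq_tendsto_of_complete (cauchySeq_of_le_geometric_two (h1 i))
  refine ⟨A, fun k i hi => ?_⟩
  have := dist_le_of_le_geometric_two_of_tendsto (h1 i) (hA i) (k - (i + 1))
  rw [dist_eq_norm, show k - (i + 1) + (i + 1) = k by omega] at this
  refine this.trans (le_of_eq ?_)
  conv_rhs => rw [show k = (i + 1) + (k - (i + 1)) by omega, pow_add]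
  simp only [one_div, inv_pow]
  ring

/-- Through `Nat.unpair` each term of the dense sequence is targeted infinitely often, with errors
tending to zero. -/
theorem denseRange_of_near {G : Type*} [NormedAddCommGroup G] [SeparableSpace G] {r : ℕ → ℕ}
    {A : ℕ → G} (hA : ∀ j, ‖denseSeq G (Nat.unpair j).1 - A (r j)‖ ≤ 4 * (1 / 2) ^ j) :
    DenseRange A := by
  refine Metric.dense_iff.2 fun x ε hε => ?_
  obtain ⟨n, hn⟩ := (denseRange_denseSeq G).exists_dist_lt x (half_pos hε)
  obtain ⟨t, ht⟩ := exists_pow_lt_of_lt_one (show 0 < ε / 8 by positivity)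
    (show (1 / 2 : ℝ) < 1 by norm_num)
  refine ⟨A (r (Nat.pair n t)), ?_, mem_range_self _⟩
  have h1 := hA (Nat.pair n t)
  rw [Nat.unpair_pair] at h1
  have h2 : (1 / 2 : ℝ) ^ (Nat.pair n t) ≤ (1 / 2) ^ t :=
    pow_le_pow_of_le_one (by norm_num) (by norm_num) (Nat.right_le_pair n t)
  rw [Metric.mem_ball, dist_comm]
  rw [← dist_eq_norm] at h1
  linarith [dist_triangle x (denseSeq G n) (A (r (Nat.pair n t)))]

variable {G H : Type*} [NormedAddCommGroup G] [NormedSpace ℝ G] [NormedAddCommGroup H]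
  [NormedSpace ℝ H]

theorem close_update (k : ℕ) (a : ℕ → G) (x : G) :
    Close k 0 (normSeq (Function.update a k x)) (normSeq a) :=
  close_normSeq fun i hi => by simp [Function.update_of_ne hi.ne]

/-- One step of the game: `x` is appended at position `k`, and the answer in `G` moves the old
entries by at most `(1 / 2) ^ k + (1 / 2) ^ (k + 1)`. -/
theorem IsGurarii.exists_next (hG : IsGurarii G) {k : ℕ} {a : ℕ → H} {b : ℕ → G}
    (h : Close k ((1 / 2) ^ k) (normSeq a) (normSeq b)) (x : H) :
    ∃ b' : ℕ → G, Close (k + 1) ((1 / 2) ^ (k + 1)) (normSeq (Function.update a k x))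
      (normSeq b') ∧ ∀ i < k, ‖b' i - b i‖ ≤ 2 * (1 / 2) ^ k := by
  obtain ⟨b', h1, h2⟩ := hG.exists_close (Nat.le_succ k) (by positivity)
    (ε := (1 / 2) ^ (k + 1)) (by positivity)
    (((close_update k a x).trans h).mono le_rfl (zero_add _).le)
  refine ⟨b', h2, fun i hi => (h1 i hi).trans ?_⟩
  have : (0 : ℝ) < (1 / 2) ^ k := by positivity
  rw [pow_succ]
  linarith

/-- Only the "forth" half is needed: the source sequence stays fixed and its images converge. -/
theorem IsGurarii.isometricallyUniversal (hG : IsGurarii G) : IsometricallyUniversal G := by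
  intro Y _ _ _ _
  have := hG.complete
  let y := denseSeq Y
  obtain ⟨s, hs⟩ := exists_rel_seq (α := ℕ → G)
    (P := fun k b => Close k ((1 / 2) ^ k) (normSeq y) (normSeq b))
    (R := fun k b b' => ∀ i < k, ‖b' i - b i‖ ≤ 2 * (1 / 2) ^ k) (x₀ := 0)
    (fun v hv => by
      have : v = 0 := Finsupp.ext fun i => hv i (Nat.zero_le i)
      simp [this])
    fun k b hb => by
      obtain ⟨b', h1, h2⟩ := hG.exists_next hb (y k)
      rw [Function.update_eq_self] at h1
      exact ⟨b', h1, h2⟩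
  obtain ⟨A, hA⟩ := exists_limit fun k => (hs k).2
  -- The constant 5 is 1 for stage `k` plus 4 for the distance to the limit.
  have hAy : normSeq A = normSeq y := (eq_of_close 5 fun k =>
    ((hs k).1.trans (close_normSeq (hA k))).mono le_rfl (by linarith)).symm
  obtain ⟨φ, -⟩ := exists_linearIsometry hAy
  obtain ⟨e⟩ := nonempty_equiv (z := y) rfl (denseRange_denseSeq Y)
  exact ⟨φ.comp e.symm.toLinearIsometry⟩

/-- Any two Gurariĭ spaces are isometric. -/
theorem IsGurarii.nonempty_equiv (hG : IsGurarii G) (hH : IsGurarii H) :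
    Nonempty (G ≃ₗᵢ[ℝ] H) := by
  have := hG.complete
  have := hG.separable
  have := hH.complete
  have := hH.separable
  let d : ℕ → G := fun j => denseSeq G (Nat.unpair j).1
  let e : ℕ → H := fun j => denseSeq H (Nat.unpair j).1
  obtain ⟨s, hs⟩ := exists_rel_seq (α := (ℕ → G) × (ℕ → H))
    (P := fun k x => Close k ((1 / 2) ^ k) (normSeq x.1) (normSeq x.2))
    (R := fun k x y => (∀ i < k, ‖y.1 i - x.1 i‖ ≤ 2 * (1 / 2) ^ k) ∧
      (∀ i < k, ‖y.2 i - x.2 i‖ ≤ 2 * (1 / 2) ^ k) ∧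
      (∀ j, k = 2 * j → y.1 k = d j) ∧ ∀ j, k = 2 * j + 1 → y.2 k = e j) (x₀ := 0)
    (fun v hv => by
      have : v = 0 := Finsupp.ext fun i => hv i (Nat.zero_le i)
      simp [this])
    fun k x hx => by
      -- Even stages insert a target point of `G` and answer in `H`; odd stages do the reverse, so
      -- both limit sequences become dense.
      obtain ⟨j, hj | hj⟩ := k.even_or_odd'
      · obtain ⟨b', h1, h2⟩ := hH.exists_next hx (d j)
        refine ⟨(Function.update x.1 k (d j), b'), h1, fun i hi => ?_, h2, fun j' hj' => ?_,
          fun j' hj' => by omega⟩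
        · simp [Function.update_of_ne hi.ne]
        · simp [show j' = j by omega]
      · obtain ⟨a', h1, h2⟩ := hG.exists_next hx.symm (e j)
        refine ⟨(a', Function.update x.2 k (e j)), h1.symm, h2, fun i hi => ?_,
          fun j' hj' => by omega, fun j' hj' => ?_⟩
        · simp [Function.update_of_ne hi.ne]
        · simp [show j' = j by omega]
  obtain ⟨A, hA⟩ := exists_limit (a := fun k => (s k).1) fun k => (hs k).2.1
  obtain ⟨A', hA'⟩ := exists_limit (a := fun k => (s k).2) fun k => (hs k).2.2.1
  have hAA : normSeq A = normSeq A' := eq_of_close 9 fun k =>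
    ((close_normSeq (hA k)).symm.trans ((hs k).1.trans (close_normSeq (hA' k)))).mono le_rfl
      (by linarith)
  have hd : DenseRange A := denseRange_of_near (r := fun j => 2 * j)
    fun j => by
      have := hA (2 * j + 1) (2 * j) (by omega)
      rw [(hs (2 * j)).2.2.2.1 j rfl] at this
      refine this.trans (mul_le_mul_of_nonneg_left ?_ (by norm_num))
      exact pow_le_pow_of_le_one (by norm_num) (by norm_num) (by omega)
  have hd' : DenseRange A' := denseRange_of_near (r := fun j => 2 * j + 1)
    fun j => by
      have := hA' (2 * j + 1 + 1) (2 * j + 1) (by omega)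
      rw [(hs (2 * j + 1)).2.2.2.2 j rfl] at this
      refine this.trans (mul_le_mul_of_nonneg_left ?_ (by norm_num))
      exact pow_le_pow_of_le_one (by norm_num) (by norm_num) (by omega)
  obtain ⟨u⟩ := BanachCoding.nonempty_equiv hAA hd
  obtain ⟨w⟩ := BanachCoding.nonempty_equiv (z := A') rfl hd'
  exact ⟨u.symm.trans w⟩

/-- Being a Gurariĭ space is invariant under isometries. -/
theorem IsGurarii.congr (hG : IsGurarii G) (u : G ≃ₗᵢ[ℝ] H) : IsGurarii H := by
  have := hG.separable
  refine ⟨(completeSpace_congr (e := u.toEquiv) u.isometry.isUniformEmbedding).1 hG.complete,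
    u.surjective.denseRange.separableSpace u.continuous, fun ε hε A F _ _ _ g => ?_⟩
  let A' : Submodule ℝ G := A.comap u.toLinearEquiv.toLinearMap
  let φ : A' →ₗᵢ[ℝ] A :=
    { toLinearMap := u.toLinearEquiv.toLinearMap.restrict (p := A') (q := A) fun x hx => hx
      norm_map' := fun x => u.norm_map x }
  obtain ⟨f, hf, hfe⟩ := hG.extension ε hε A' F (g.comp φ)
  refine ⟨(u.toContinuousLinearEquiv.toContinuousLinearMap).comp f, fun x => ?_,
    ContinuousLinearMap.opNorm_le_bound _ hε.le fun x => ?_⟩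
  · change _ ≤ ‖u (f x)‖ ∧ ‖u (f x)‖ ≤ _
    rw [u.norm_map]
    exact hf x
  · let x' : A' := ⟨u.symm x, by simp [A']⟩
    have hx : φ x' = x := Subtype.ext (u.apply_symm_apply x)
    have := (f.comp (g.comp φ).toContinuousLinearMap - A'.subtypeL).le_of_opNorm_le hfe x'
    change ‖f (g (φ x')) - u.symm x‖ ≤ ε * ‖u.symm (x : H)‖ at this
    change ‖u (f (g x)) - x‖ ≤ ε * ‖(x : H)‖
    rw [hx, u.symm.norm_map, ← u.norm_map, map_sub, u.apply_symm_apply] at this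
    exact this

/-- Uniqueness and isometric invariance identify the isometry class with the Gurariĭ property. -/
theorem IsGurarii.preimage_eq {I : Set PseudoNorm} (hG : IsGurarii G) :
    isometryClass I G = (↑) ⁻¹' gurariiSet := by
  ext μ
  exact ⟨fun ⟨u⟩ => mem_gurariiSet_iff.2 (hG.congr u.symm),
    fun h => (mem_gurariiSet_iff.1 h).nonempty_equiv hG⟩

theorem IsGurarii.isGδ_isometryClass (hG : IsGurarii G) (I : Set PseudoNorm) :
    IsGδ (isometryClass I G) := by
  rw [hG.preimage_eq]
  exact isGδ_gurariiSet.preimage continuous_subtype_val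

end BackAndForth

/-! ### Density of the complement and of universal isometry classes -/

section Density

/-- The pseudonorm given by `μ` on the first `n` coordinates and by the `ℓ₁`-norm on the others. -/
noncomputable def l1Tail (μ : PseudoNorm) (n : ℕ) : PseudoNorm :=
  μ.comp (proj n) + l1.comp (LinearMap.id - proj n)

theorem l1Tail_apply (μ : PseudoNorm) (n : ℕ) (v : V) :
    l1Tail μ n v = μ (proj n v) + l1 (v - proj n v) := rfl

theorem l1Tail_mem_B {μ : PseudoNorm} (hμ : μ ∈ B) (n : ℕ) : l1Tail μ n ∈ B := by
  rw [B_eq, mem_iInter] at hμ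
  obtain ⟨c, hc, h⟩ := hμ n
  refine mem_B_of_le (c := min c 1) (lt_min hc one_pos) fun v => ?_
  have h1 := h _ (suppLT_proj n v)
  have h2 : l1 v ≤ l1 (proj n v) + l1 (v - proj n v) := by
    have := map_add_le_add l1 (proj n v) (v - proj n v)
    rwa [add_sub_cancel] at this
  have h3 : min c 1 * l1 (proj n v) ≤ c * l1 (proj n v) :=
    mul_le_mul_of_nonneg_right (min_le_left _ _) (apply_nonneg _ _)
  have h4 : min c 1 * l1 (v - proj n v) ≤ 1 * l1 (v - proj n v) :=
    mul_le_mul_of_nonneg_right (min_le_right _ _) (apply_nonneg _ _)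
  have h5 := mul_le_mul_of_nonneg_left h2 (le_min hc.le zero_le_one)
  rw [l1Tail_apply]
  linarith

theorem l1Tail_eq {μ : PseudoNorm} {n : ℕ} {v : V} (hv : SuppLT n v) : l1Tail μ n v = μ v := by
  rw [l1Tail_apply, hv.proj_eq, sub_self, map_zero, add_zero]

theorem l1_add_single {w : V} {n : ℕ} (hw : w n = 0) (r : ℚ) :
    l1 (w + Finsupp.single n r) = l1 w + |(r : ℝ)| := by
  classical
  have hn : n ∉ w.support := by simpa using hw
  have hs : (w + Finsupp.single n r).support ⊆ insert n w.support := by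
    refine Finsupp.support_add.trans (Finset.union_subset (Finset.subset_insert _ _) ?_)
    exact Finsupp.support_single_subset.trans (by simp)
  rw [l1_eq _ hs, l1_eq w subset_rfl, Finset.sum_insert hn, add_comm]
  congr 1
  · refine Finset.sum_congr rfl fun i hi => ?_
    have : n ≠ i := fun h => hn (h ▸ hi)
    simp [this]
  · simp [hw]

theorem l1Tail_add_single (μ : PseudoNorm) {z : V} {n : ℕ} (hz : z n = 0) (r : ℚ) :
    l1Tail μ n (z + Finsupp.single n r) = l1Tail μ n z + |(r : ℝ)| := by
  have h1 : proj n (z + Finsupp.single n r) = proj n z := by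
    ext i
    rw [proj_apply, proj_apply]
    split_ifs with h
    · simp [h.ne']
    · rfl
  have h2 : (z - proj n z) n = 0 := by simp [proj_apply, hz]
  rw [l1Tail_apply, l1Tail_apply, h1, add_sub_right_comm, l1_add_single h2, add_assoc]

/-- In a Gurariĭ space every unit vector `e` has a companion `y` with `‖y‖`, `‖e + y‖` and `‖e - y‖`
all close to 1, as in the max-norm plane. Here `e = E ν n` spans an `ℓ₁`-summand, so one of `‖y +
e‖`, `‖y - e‖` equals `‖y‖ + 1`, which is near 2. -/
theorem not_isGurarii_l1Tail (μ : PseudoNorm) (n : ℕ) : ¬ IsGurarii (X (l1Tail μ n)) := by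
  intro hG
  set ν := l1Tail μ n with hν
  let z : ℕ → ℝ × ℝ := fun i => if i = 0 then (1, 0) else (0, 1)
  have hE : ‖E ν n‖ = 1 := by
    have := l1Tail_add_single μ (z := 0) (n := n) rfl 1
    rw [zero_add, map_zero, zero_add] at this
    rw [norm_E, hν, this]
    simp
  have hc : Close 1 0 (normSeq z) (normSeq fun _ => E ν n) := fun v hv => by
    rw [normSeq_apply, normSeq_apply, hv.lc_eq, hv.lc_eq]
    simp [z, norm_smul, hE]
  obtain ⟨h, h1, h2⟩ := hG.exists_close (m := 2) (by norm_num) le_rfl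
    (ε := 1 / 16) (by norm_num) hc
  have h0 := h1 0 one_pos
  obtain ⟨v, hv⟩ := exists_coeX_near (h 1) (ε := 1 / 16) (by norm_num)
  have r1 := (abs_le.1 (h2.real fun i => if i = 0 then 0 else 1)).2
  have r2 := (abs_le.1 (h2.real fun i => if i = 0 then 1 else 1)).1
  have r3 := (abs_le.1 (h2.real fun i => if i = 0 then 1 else -1)).1
  simp [Finset.sum_range_succ, z, Prod.norm_def] at r1 r2 r3
  set w : V := v - Finsupp.single n (v n) with hw
  have hwn : w n = 0 := by simp [hw]
  have e1 : ν v = ν w + |(v n : ℝ)| := by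
    rw [hν, ← l1Tail_add_single μ hwn, hw, sub_add_cancel]
  have e2 : ν (v + Finsupp.single n 1) = ν w + |(v n : ℝ) + 1| := by
    have := l1Tail_add_single μ hwn (v n + 1)
    rw [Finsupp.single_add, ← add_assoc, hw, sub_add_cancel] at this
    rw [hν, this]
    push_cast
    rfl
  have e3 : ν (v - Finsupp.single n 1) = ν w + |(v n : ℝ) - 1| := by
    have := l1Tail_add_single μ hwn (v n - 1)
    rw [Finsupp.single_sub, ← add_sub_assoc, hw, sub_add_cancel] at this
    rw [hν, this]
    push_cast
    rfl
  rw [← norm_coeX] at e1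
  rw [← norm_coeX, coeX_add, coeX_single] at e2
  rw [← norm_coeX, coeX_sub, coeX_single] at e3
  have n1 : ‖h 1‖ ≤ ‖coeX ν v‖ + ‖coeX ν v - h 1‖ := by
    have := norm_sub_le (coeX ν v) (coeX ν v - h 1)
    rwa [sub_sub_cancel] at this
  have n2 : ‖coeX ν v + E ν n‖ ≤ ‖h 0 + h 1‖ + ‖coeX ν v - h 1‖ + ‖h 0 - E ν n‖ := by
    have := norm_add₃_le (a := h 0 + h 1) (b := coeX ν v - h 1) (c := -(h 0 - E ν n))
    rw [norm_neg] at this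
    rwa [show h 0 + h 1 + (coeX ν v - h 1) + -(h 0 - E ν n) = coeX ν v + E ν n by abel] at this
  have n3 : ‖coeX ν v - E ν n‖ ≤ ‖h 0 - h 1‖ + ‖coeX ν v - h 1‖ + ‖h 0 - E ν n‖ := by
    have := norm_add₃_le (a := -(h 0 - h 1)) (b := coeX ν v - h 1) (c := h 0 - E ν n)
    rw [norm_neg] at this
    rwa [show -(h 0 - h 1) + (coeX ν v - h 1) + (h 0 - E ν n) = coeX ν v - E ν n by abel] at this
  rw [← sub_eq_add_neg] at r3
  rcases le_total 0 (v n : ℝ) with ht | ht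
  · rw [abs_of_nonneg ht] at e1
    rw [abs_of_nonneg (by linarith)] at e2
    linarith
  · rw [abs_of_nonpos ht] at e1
    rw [abs_of_nonpos (by linarith)] at e3
    linarith

theorem IsGurarii.dense_compl_isometryClass {G : Type*} [NormedAddCommGroup G] [NormedSpace ℝ G]
    (hG : IsGurarii G) : Dense (isometryClass B G)ᶜ :=
  dense_in_B fun μ hμ n ε hε => ⟨⟨l1Tail μ n, l1Tail_mem_B hμ n⟩,
    fun ⟨u⟩ => not_isGurarii_l1Tail μ n (hG.congr u.symm), fun v hv => by
      rw [l1Tail_eq hv, sub_self, abs_zero]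
      exact mul_nonneg hε.le (apply_nonneg _ _)⟩

variable {Z : Type*} [NormedAddCommGroup Z] [NormedSpace ℝ Z]

/-- A proper subspace has empty interior, and a finite-dimensional one is proper here because `z` is
infinite and independent. -/
theorem exists_near_notMem {z : ℕ → Z} (hz : LinearIndependent ℝ z) {s : Set Z} (hs : s.Finite)
    (x : Z) {ε : ℝ} (hε : 0 < ε) : ∃ y, y ∉ Submodule.span ℝ s ∧ ‖x - y‖ < ε := by
  have hW : FiniteDimensional ℝ (Submodule.span ℝ s) := FiniteDimensional.span_of_finite ℝ hs
  have hne : Submodule.span ℝ s ≠ ⊤ := fun h => by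
    rw [h] at hW
    have : FiniteDimensional ℝ Z := Module.Finite.equiv (Submodule.topEquiv (R := ℝ) (M := Z))
    exact not_finite_iff_infinite.2 (inferInstanceAs (Infinite ℕ)) hz.finite
  have hd : Dense (Submodule.span ℝ s : Set Z)ᶜ := by
    rw [← interior_eq_empty_iff_dense_compl, ← not_nonempty_iff_eq_empty]
    exact fun h => hne (Submodule.eq_top_of_nonempty_interior' _ h)
  obtain ⟨y, hy, hxy⟩ := Metric.dense_iff.1 hd x ε hε
  rw [Metric.mem_ball, dist_comm, dist_eq_norm] at hy
  exact ⟨y, hxy, hy⟩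

/-- The first `n` terms of a linearly independent sequence in a separable normed space extend to a
linearly independent sequence with dense range. -/
theorem exists_linearIndependent_denseRange [SeparableSpace Z] {z : ℕ → Z}
    (hz : LinearIndependent ℝ z) (n : ℕ) :
    ∃ z' : ℕ → Z, LinearIndependent ℝ z' ∧ (∀ i < n, z' i = z i) ∧ DenseRange z' := by
  obtain ⟨s, hs⟩ := exists_rel_seq (α := ℕ → Z)
    (P := fun k f => LinearIndepOn ℝ f (Iio (n + k)) ∧ ∀ i < n, f i = z i)
    (R := fun k f f' => (∀ i < n + k, f' i = f i) ∧
      ‖denseSeq Z (Nat.unpair k).1 - f' (n + k)‖ ≤ 4 * (1 / 2) ^ k) (x₀ := z)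
    ⟨hz.linearIndepOn _, fun _ _ => rfl⟩
    fun k f ⟨h1, h2⟩ => by
      obtain ⟨y, hy, hxy⟩ := exists_near_notMem hz ((finite_Iio (n + k)).image f)
        (denseSeq Z (Nat.unpair k).1) (ε := 4 * (1 / 2) ^ k) (by positivity)
      have he : EqOn f (Function.update f (n + k) y) (Iio (n + k)) := fun i hi =>
        (Function.update_of_ne (mem_Iio.1 hi).ne _ _).symm
      refine ⟨Function.update f (n + k) y, ⟨?_, fun i hi => ?_⟩, fun i hi => (he hi).symm, ?_⟩
      · rw [show Iio (n + (k + 1)) = insert (n + k) (Iio (n + k)) by ext i; simp; omega]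
        refine (h1.congr he).insert ?_
        rwa [Function.update_self, ← he.image_eq]
      · rw [Function.update_of_ne (by omega), h2 i hi]
      · rw [Function.update_self]
        exact hxy.le
  -- Entries below `n + k` are final from stage `k` on, so entry `i` may be read off at stage `i +
  -- 1`.
  have hst : ∀ k l, k ≤ l → ∀ i < n + k, s l i = s k i := fun k l hkl => by
    induction l, hkl using Nat.le_induction with
    | base => exact fun _ _ => rfl
    | succ l hl ih => exact fun i hi => ((hs l).2.1 i (by omega)).trans (ih i hi)
  have hz' : ∀ k, ∀ i < n + k, s (i + 1) i = s k i := fun k i hi => by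
    rcases le_total k (i + 1) with h | h
    · exact hst _ _ h i hi
    · exact (hst _ _ h i (by omega)).symm
  refine ⟨fun i => s (i + 1) i, ?_, fun i hi => (hs (i + 1)).1.2 i hi, ?_⟩
  · have : (univ : Set ℕ) = ⋃ k, Iio (n + k) :=
      
by
      refine (eq_univ_of_forall fun i => mem_iUnion.2 ⟨i + 1, ?_⟩).symm
      exact mem_Iio.2 (by omega)
    rw [← linearIndepOn_univ_iff, this]
    refine linearIndepOn_iUnion_of_directed
      (Monotone.directed_le fun a b hab => Iio_subset_Iio (by omega)) fun k => ?_
    exact (hs k).1.1.congr fun i hi => (hz' k i hi).symm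
  · refine denseRange_of_near (r := fun k => n + k) fun k => ?_
    rw [hz' (k + 1) (n + k) (by omega)]
    exact (hs k).2.2

/-- Copy `X μ` inside `Z`, keep the first `n` basis images and replace the rest so that the sequence
stays independent but has dense range in `Z`. Its pseudonorm agrees with `μ` on the first `n`
coordinates. -/
theorem IsometricallyUniversal.dense_isometryClass [CompleteSpace Z] [SeparableSpace Z]
    (hZ : IsometricallyUniversal Z) : Dense (isometryClass B Z) := by
  refine dense_in_B fun μ hμ n ε hε => ?_
  obtain ⟨φ⟩ := hZ (X μ)
  have hli : LinearIndependent ℝ fun i => φ (E μ i) :=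
    ((mem_B_iff μ).1 hμ).map' φ.toLinearMap (LinearMap.ker_eq_bot.2 φ.injective)
  obtain ⟨z', h1, h2, h3⟩ := exists_linearIndependent_denseRange hli n
  obtain ⟨ψ, hψ⟩ := exists_linearIsometry (z := z') rfl
  refine ⟨⟨normSeq z', (mem_B_iff _).2 ?_⟩, nonempty_equiv rfl h3, ?_⟩
  · refine LinearIndependent.of_comp ψ.toLinearMap ?_
    convert h1 using 1
    exact funext hψ
  · have := close_normSeq (n := n) (δ := 0) (z := fun i => φ (E μ i)) (w := z')
      fun i hi => by rw [h2 i hi, sub_self, norm_zero]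
    rw [normSeq_comp, normSeq_E] at this
    exact this.mono le_rfl hε.le

end Density

/-! ### Dense `G_δ` sets with dense complement are `G_δ`-hard -/

section Hardness

open Filter Topology

theorem exists_disjoint_clopen {Y : Type*} [TopologicalSpace Y] [SecondCountableTopology Y]
    (hY : IsTopologicalBasis {U : Set Y | IsClopen U}) {U : Set Y} (hU : IsOpen U) :
    ∃ C : ℕ → Set Y, (∀ i, IsClopen (C i)) ∧ Pairwise (Function.onFun Disjoint C) ∧
      ⋃ i, C i = U := by
  obtain ⟨S, hS, rfl⟩ := hY.open_eq_sUnion hU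
  obtain ⟨T, hT, hTS, hTU⟩ := isOpen_sUnion_countable S fun s hs => (hS hs).isOpen
  obtain ⟨K, hK⟩ := (hT.insert ∅).exists_eq_range (insert_nonempty _ _)
  have hKc : ∀ i, IsClopen (K i) := fun i => by
    have : K i ∈ insert ∅ T := hK ▸ mem_range_self i
    rcases this with h | h
    · rw [h]
      exact isClopen_empty
    · exact hS (hTS h)
  refine ⟨disjointed K, fun i => ?_, disjoint_disjointed K, ?_⟩
  · exact disjointedRec (p := IsClopen) (fun _ i h => h.diff (hKc i)) (hKc i)
  · rw [iUnion_disjointed, ← sUnion_range, ← hK, sUnion_insert, empty_union, hTU]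

/-- A dense `G_δ` subset with dense complement of a Polish space is `G_δ`-hard. -/
theorem isGδHard_of_dense {S : Type*} [TopologicalSpace S] [PolishSpace S] [Nonempty S] {A : Set S}
    (hA : IsGδ A) (hd : Dense A) (hd' : Dense Aᶜ) : IsGδHard A := by
  intro Y _ _ hY D hD
  let _ := upgradeIsCompletelyMetrizable S
  obtain ⟨W, hW, rfl⟩ := hA.eq_iInter_nat
  obtain ⟨U', hU', rfl⟩ := hD.eq_iInter_nat
  set A := ⋂ n, W n
  have hWd : ∀ n, Dense (W n) := fun n => hd.mono (iInter_subset W n)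
  let U : ℕ → Set Y := fun n => ⋂ i ∈ Finset.range (n + 1), U' i
  have hU : ∀ n, IsOpen (U n) := fun n => isOpen_biInter_finset fun i _ => hU' i
  have hUanti : ∀ {n m}, n ≤ m → U m ⊆ U n := fun h =>
    biInter_subset_biInter_left fun i hi => by
      simp only [Finset.coe_range, mem_Iio] at hi ⊢
      omega
  have hUD : ∀ y, y ∈ ⋂ n, U' n ↔ ∀ n, y ∈ U n := fun y => by
    simp only [mem_iInter, U, Finset.mem_range]
    exact ⟨fun h n i _ => h i, fun h n => h n n (Nat.lt_succ_self n)⟩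
  choose C hC hCd hCU using fun n => exists_disjoint_clopen hY (hU n)
  -- nodes of the tree of balls
  let N : Type _ := {x : S × ℝ // x.1 ∉ A ∧ 0 < x.2}
  -- Child balls enter `W n` but keep centres outside `A`. The factor `1 / (i + 2)` makes the
  -- children converge to the parent's centre as `i` grows, which is what continuity off `D` needs.
  have hchild : ∀ (n : ℕ) (x : N) (i : ℕ), ∃ x' : N, x'.1.2 ≤ x.1.2 / 2 ∧
      Metric.closedBall x'.1.1 x'.1.2 ⊆ W n ∩ Metric.ball x.1.1 (x.1.2 / (i + 2)) := by
    rintro n ⟨⟨p, r⟩, -, hr⟩ i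
    simp only at hr
    have ho : IsOpen (W n ∩ Metric.ball p (r / (i + 2))) := (hW n).inter Metric.isOpen_ball
    have hne : (W n ∩ Metric.ball p (r / (i + 2))).Nonempty := by
      rw [inter_comm]
      exact (hWd n).inter_open_nonempty _ Metric.isOpen_ball
        ⟨p, Metric.mem_ball_self (by positivity)⟩
    obtain ⟨p', hp', hpA⟩ := hd'.inter_open_nonempty _ ho hne
    obtain ⟨ρ, hρ, hb⟩ := Metric.isOpen_iff.1 ho p' hp'
    refine ⟨⟨(p', min (ρ / 2) (r / 2)), hpA, by simp only; positivity⟩, min_le_right _ _, ?_⟩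
    exact (Metric.closedBall_subset_ball ((min_le_left _ _).trans_lt (half_lt_self hρ))).trans hb
  choose child hchr hchb using hchild
  obtain ⟨p₀, hp₀⟩ := hd'.nonempty
  classical
  -- The path of `y` moves to child `i` at level `k` when `y ∈ C k i`, and stops for good once `y`
  -- leaves the decreasing sets `U k`.
  let nd : ℕ → Y → N := fun k y => Nat.rec ⟨(p₀, 1), hp₀, one_pos⟩
    (fun k x => if h : ∃ i, y ∈ C k i then child k x (Nat.find h) else x) k
  have nd_in : ∀ k y i, y ∈ C k i → nd (k + 1) y = child k (nd k y) i := fun k y i hi => by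
    have h : ∃ i, y ∈ C k i := ⟨i, hi⟩
    have e : Nat.find h = i := by
      by_contra hne
      exact disjoint_left.1 (hCd k hne) (Nat.find_spec h) hi
    change (if h : ∃ i, y ∈ C k i then child k (nd k y) (Nat.find h) else nd k y) = _
    rw [dif_pos h, e]
  have nd_out : ∀ k y, y ∉ U k → nd (k + 1) y = nd k y := fun k y hy => by
    change (if h : ∃ i, y ∈ C k i then child k (nd k y) (Nat.find h) else nd k y) = _
    rw [dif_neg]
    rintro ⟨i, hi⟩
    exact hy (hCU k ▸ mem_iUnion.2 ⟨i, hi⟩)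
  let ball : ℕ → Y → Set S := fun k y => Metric.closedBall (nd k y).1.1 (nd k y).1.2
  have mem_ball : ∀ k y, (nd k y).1.1 ∈ ball k y := fun k y =>
    Metric.mem_closedBall_self (nd k y).2.2.le
  have hdiv : ∀ (x : N) (i : ℕ), x.1.2 / (i + 2) ≤ x.1.2 := fun x i =>
    div_le_self x.2.2.le (by
      have : (0 : ℝ) ≤ i := Nat.cast_nonneg i
      linarith)
  have ball_step : ∀ k y, ball (k + 1) y ⊆ ball k y := fun k y => by
    by_cases hy : y ∈ U k
    · obtain ⟨i, hi⟩ := mem_iUnion.1 (hCU k ▸ hy)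
      simp only [ball]
      rw [nd_in k y i hi]
      refine (hchb k (nd k y) i).trans (inter_subset_right.trans ?_)
      exact (Metric.ball_subset_ball (hdiv _ i)).trans Metric.ball_subset_closedBall
    · simp only [ball]
      rw [nd_out k y hy]
  have ball_anti : ∀ y, Antitone fun k => ball k y := fun y => antitone_nat_of_succ_le
    fun k => ball_step k y
  have rad : ∀ k y, (∀ j < k, y ∈ U j) → (nd k y).1.2 ≤ (1 / 2) ^ k := fun k => by
    induction k with
    | zero => exact fun y _ => (pow_zero (1 / 2 : ℝ)).ge
    | succ k ih =>
      intro y hy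
      obtain ⟨i, hi⟩ := mem_iUnion.1 (hCU k ▸ hy k (Nat.lt_succ_self k))
      rw [nd_in k y i hi, pow_succ]
      linarith [hchr k (nd k y) i, ih y fun j hj => hy j (by omega)]
  have rad_one : ∀ k y, (nd k y).1.2 ≤ 1 := fun k y => by
    induction k with
    | zero => exact le_rfl
    | succ k ih =>
      by_cases hy : y ∈ U k
      · obtain ⟨i, hi⟩ := mem_iUnion.1 (hCU k ▸ hy)
        rw [nd_in k y i hi]
        linarith [hchr k (nd k y) i, (nd k y).2.2]
      · rw [nd_out k y hy]
        exact ih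
  have loc : ∀ k y, (∀ j < k, y ∈ U j) → ∀ᶠ y' in 𝓝 y, nd k y' = nd k y := fun k => by
    induction k with
    | zero => exact fun y _ => Eventually.of_forall fun _ => rfl
    | succ k ih =>
      intro y hy
      obtain ⟨i, hi⟩ := mem_iUnion.1 (hCU k ▸ hy k (Nat.lt_succ_self k))
      filter_upwards [ih y fun j hj => hy j (by omega), (hC k i).isOpen.mem_nhds hi] with y' h1 h2
      rw [nd_in k y i hi, nd_in k y' i h2, h1]
  have stuck : ∀ y k, y ∉ U k → ∀ l, k ≤ l → nd l y = nd k y := fun y k hk l hl => by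
    induction l, hl using Nat.le_induction with
    | base => rfl
    | succ l hl ih => rw [nd_out l y fun h => hk (hUanti hl h), ih]
  -- The value at `y` is the limit of the centres along an infinite path, hence in every `W n`, or
  -- the last centre of a path that stops, hence outside `A`.
  have hf : ∀ y, ∃ x, (∀ k, x ∈ ball k y) ∧ ∀ k, y ∉ U k → x = (nd k y).1.1 := fun y => by
    by_cases hy : ∀ n, y ∈ U n
    · have hc : CauchySeq fun k => (nd k y).1.1 := by
        refine cauchySeq_of_le_tendsto_0 (fun k => (1 / 2 : ℝ) ^ k + (1 / 2) ^ k)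
          (fun m n k hm hn => ?_) ?_
        · have h1 := Metric.mem_closedBall.1 (ball_anti y hm (mem_ball m y))
          have h2 := Metric.mem_closedBall.1 (ball_anti y hn (mem_ball n y))
          have h3 := rad k y fun j _ => hy j
          linarith [dist_triangle_right (nd m y).1.1 (nd n y).1.1 (nd k y).1.1]
        · have := tendsto_pow_atTop_nhds_zero_of_lt_one (r := (1 / 2 : ℝ)) (by norm_num)
            (by norm_num)
          simpa using this.add this
      obtain ⟨x, hx⟩ := cauchySeq_tendsto_of_complete hc
      refine ⟨x, fun k => Metric.isClosed_closedBall.mem_of_tendsto hx ?_,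
        fun k hk => absurd (hy k) hk⟩
      filter_upwards [eventually_ge_atTop k] with l hl
      exact ball_anti y hl (mem_ball l y)
    · push Not at hy
      obtain ⟨k, hk⟩ := hy
      refine ⟨(nd k y).1.1, fun l => ?_, fun l hl => ?_⟩
      · rcases le_total k l with h | h
        · simp only [ball]
          rw [stuck y k hk l h]
          exact mem_ball k y
        · exact ball_anti y h (mem_ball k y)
      · rcases le_total k l with h | h
        · rw [stuck y k hk l h]
        · rw [stuck y l hl k h]
  choose f hfb hfs using hf
  refine ⟨f, continuous_iff_continuousAt.2 fun y => Metric.tendsto_nhds.2 fun ε hε => ?_, ?_⟩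
  · by_cases hy : ∀ n, y ∈ U n
    · obtain ⟨k, hk⟩ := exists_pow_lt_of_lt_one (half_pos hε) (show (1 / 2 : ℝ) < 1 by norm_num)
      filter_upwards [loc k y fun j _ => hy j] with y' h
      have h1 := Metric.mem_closedBall.1 (hfb y' k)
      have h2 := Metric.mem_closedBall.1 (hfb y k)
      rw [h] at h1
      have h3 := rad k y fun j _ => hy j
      linarith [dist_triangle_right (f y') (f y) (nd k y).1.1]
    · push Not at hy
      have hk := Nat.find_spec hy
      set k := Nat.find hy
      have hj : ∀ j < k, y ∈ U j := fun j hj => not_not.1 (Nat.find_min hy hj)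
      -- Near `y` the path agrees up to level `k`. A nearby point either stops there too or enters a
      -- child of index above `I`, since finitely many clopen sets missing `y` can be avoided; that
      -- child lies within `1 / (I + 1)` of the centre.
      obtain ⟨I, hI⟩ := exists_nat_one_div_lt hε
      have hout : ∀ᶠ y' in 𝓝 y, ∀ i ∈ Finset.range (I + 1), y' ∉ C k i := by
        refine (Finset.eventually_all _).2 fun i _ => ?_
        exact (hC k i).compl.isOpen.mem_nhds fun h => hk (hCU k ▸ mem_iUnion.2 ⟨i, h⟩)
      filter_upwards [loc k y hj, hout] with y' h h'
      rw [hfs y k hk, ← h]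
      by_cases hy' : y' ∈ U k
      · obtain ⟨i, hi⟩ := mem_iUnion.1 (hCU k ▸ hy')
        have hIi : I + 1 ≤ i := by
          by_contra hlt
          exact h' i (Finset.mem_range.2 (by omega)) hi
        have h1 := hfb y' (k + 1)
        simp only [ball] at h1
        rw [nd_in k y' i hi] at h1
        have h2 := Metric.mem_ball.1 (hchb k (nd k y') i h1).2
        refine h2.trans (lt_of_le_of_lt ?_ hI)
        have h3 : ((I : ℝ) + 1) ≤ i := by exact_mod_cast hIi
        exact div_le_div₀ zero_le_one (rad_one k y') (by positivity) (by linarith)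
      · rw [hfs y' k hy', dist_self]
        exact hε
  · ext y
    rw [hUD]
    constructor
    · intro hy
      by_contra hn
      push Not at hn
      obtain ⟨k, hk⟩ := hn
      rw [mem_preimage, hfs y k hk] at hy
      exact (nd k y).2.1 hy
    · intro hy
      refine mem_iInter.2 fun k => ?_
      obtain ⟨i, hi⟩ := mem_iUnion.1 (hCU k ▸ hy k)
      have h1 := hfb y (k + 1)
      simp only [ball] at h1
      rw [nd_in k y i hi] at h1
      exact (hchb k (nd k y) i h1).1

end Hardness

/-! ### Assembling the corollary -/

section Main

variable {G Z : Type*} [NormedAddCommGroup G] [NormedSpace ℝ G] [NormedAddCommGroup Z]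
  [NormedSpace ℝ Z]

theorem continuous_inclusion_B : Continuous (Set.inclusion fun _ h => h.1 : B → PInf) :=
  continuous_inclusion _

theorem IsGurarii.dense_isometryClass (hG : IsGurarii G) : Dense (isometryClass B G) := by
  rw [hG.preimage_eq]
  exact dense_gurariiSet

theorem IsGurarii.isGδComplete_B (hG : IsGurarii G) : IsGδComplete (isometryClass B G) :=
  ⟨hG.isGδ_isometryClass B, isGδHard_of_dense (hG.isGδ_isometryClass B) hG.dense_isometryClass
    hG.dense_compl_isometryClass⟩

/-- Hardness transfers along the inclusion of `B`, because the class in `B` is the preimage of the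
class in `PInf`. -/
theorem IsGurarii.isGδComplete_PInf (hG : IsGurarii G) :
    IsGδComplete (isometryClass PInf G) := by
  refine ⟨hG.isGδ_isometryClass PInf, fun Y _ _ hY D hD => ?_⟩
  obtain ⟨f, hf, hfD⟩ := hG.isGδComplete_B.2 Y hY D hD
  exact ⟨_, continuous_inclusion_B.comp hf, hfD⟩

theorem isGδ_isometryClass_B (h : IsGδ (isometryClass PInf Z)) : IsGδ (isometryClass B Z) := by
  have e : isometryClass B Z =
      (Set.inclusion fun _ h => h.1 : B → PInf) ⁻¹' isometryClass PInf Z := rfl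
  rw [e]
  exact h.preimage continuous_inclusion_B

/-- By Baire's theorem two dense `G_δ` classes in `B` share a pseudonorm, whose space is isometric
to both. -/
theorem IsGurarii.nonempty_equiv_of_isGδ [CompleteSpace Z] [SeparableSpace Z] (hG : IsGurarii G)
    (hZ : IsometricallyUniversal Z) (h : IsGδ (isometryClass B Z)) : Nonempty (Z ≃ₗᵢ[ℝ] G) := by
  obtain ⟨μ, ⟨u⟩, ⟨w⟩⟩ := (hZ.dense_isometryClass.inter_of_Gδ h (hG.isGδ_isometryClass B)
    hG.dense_isometryClass).nonempty
  exact ⟨u.symm.trans w⟩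

end Main

end BanachCoding

theorem corollary3p2 :
    (∃ (G : Type) (_ : NormedAddCommGroup G) (_ : NormedSpace ℝ G), BanachCoding.IsGurarii G) ∧
    ∀ (G : Type*) [NormedAddCommGroup G] [NormedSpace ℝ G], BanachCoding.IsGurarii G →
      BanachCoding.IsometricallyUniversal G ∧
      IsGδ (BanachCoding.isometryClass BanachCoding.B G) ∧
      IsGδ (BanachCoding.isometryClass BanachCoding.PInf G) ∧
      (∀ (Z : Type*) [NormedAddCommGroup Z] [NormedSpace ℝ Z] [CompleteSpace Z]
        [TopologicalSpace.SeparableSpace Z], BanachCoding.IsometricallyUniversal Z →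
        (IsGδ (BanachCoding.isometryClass BanachCoding.B Z) → Nonempty (Z ≃ₗᵢ[ℝ] G)) ∧
        (IsGδ (BanachCoding.isometryClass BanachCoding.PInf Z) → Nonempty (Z ≃ₗᵢ[ℝ] G))) ∧
      BanachCoding.IsGδComplete (BanachCoding.isometryClass BanachCoding.B G) ∧
      BanachCoding.IsGδComplete (BanachCoding.isometryClass BanachCoding.PInf G) := by
  refine ⟨BanachCoding.exists_isGurarii, ?_⟩
  intro G _ _ hG
  refine ⟨hG.isometricallyUniversal, hG.isGδ_isometryClass _, hG.isGδ_isometryClass _, ?_,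
    hG.isGδComplete_B, hG.isGδComplete_PInf⟩
  intro Z _ _ _ _ hZ
  exact ⟨hG.nonempty_equiv_of_isGδ hZ,
    fun h => hG.nonempty_equiv_of_isGδ hZ (BanachCoding.isGδ_isometryClass_B h)⟩
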